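/- Let $K$ be a field, let $r\ge 1$ and $n_1,\dots,n_r\ge 1$ be integers, put $N=n_1+\cdots+n_r$ and $S=K[x_1,\dots,x_N]$ with the standard grading, and let $$I=I_{n_1,\dots,n_r}=(x_1,\dots,x_{n_1})\cap(x_{n_1+1},\dots,x_{n_1+n_2})\cap\cdots\cap(x_{n_1+\cdots+n_{r-1}+1},\dots,x_N)\subset S .$$ For a finitely generated graded $S$-module $M$ let $\operatorname{hdepth}(M)$, the Hilbert depth of $M$, be the maximal depth of a finitely generated graded $S$-module with the same Hilbert series as $M$. For $x\in\mathbb Z$ and an integer $k\ge 0$ let $\binom{x}{k}=x(x-1)\cdots(x-k+1)/k!$, and write $[r]=\{1,\dots,r\}$. Then $$\begin{aligned}(1)\quad \operatorname{hdepth}(I)=\max\Big\{d\in\mathbb Z\;:\;&\sum_{i=1}^r\Big\lceil\frac{n_i}{2}\Big\rceil\le d\le\Big\lfloor\frac{N+r}{2}\Big\rfloor\ \text{ and }\\ &\sum_{J\subseteq[r]}(-1)^{|J|}\binom{N-\sum_{i\in J}n_i-d+k-1}{k}\ge 0\ \text{ for all } r\le k\le d\Big\},\end{aligned}$$ $$\begin{aligned}(2)\quad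 \operatorname{hdepth}(S/I)=\max\Big\{d\in\mathbb Z\;:\;&\sum_{i=1}^r\Big\lceil\frac{n_i}{2}\Big\rceil-\min_{1\le i\le r}\Big\lceil\frac{n_i}{2}\Big\rceil\le d\le N-\min_{1\le i\le r}n_i\ \text{ and }\\ &\sum_{\emptyset\ne J\subseteq[r]}(-1)^{|J|+1}\binom{N-\sum_{i\in J}n_i-d+k-1}{k}\ge 0\ \text{ for all } r\le k\le d\Big\}.\end{aligned}$$ In particular, both sets are nonempty, so that the maxima exist. -/

import Mathlib

open MvPolynomial

universe u

namespace HilbertDepth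

/-- The standard `ℤ`-grading of the polynomial ring `S = K[x_v : v ∈ σ]`: the piece of degree `k`
is the space of homogeneous polynomials of degree `k` (it is zero for `k < 0`). -/
noncomputable abbrev stdGrading (K : Type u) [Field K] (σ : Type) :
    ℤ → Submodule K (MvPolynomial σ K) :=
  weightedHomogeneousSubmodule K (fun _ : σ => (1 : ℤ))

/-- `ℳ` is a grading of the `S`-module `M`: `M` is the direct sum of the `K`-subspaces `ℳ k`,
`k ∈ ℤ`, and `S_i ℳ_j ⊆ ℳ_{i+j}`. -/
structure IsGrading {K : Type u} [Field K] {σ : Type} {M : Type u} [AddCommGroup M]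
    [Module K M] [Module (MvPolynomial σ K) M] (ℳ : ℤ → Submodule K M) : Prop where
  isInternal : DirectSum.IsInternal ℳ
  smul_mem : ∀ (i j : ℤ) (f : MvPolynomial σ K) (m : M),
    f ∈ stdGrading K σ i → m ∈ ℳ j → f • m ∈ ℳ (i + j)

/-- The depth of an `S`-module `M`: the supremum of the lengths of the `M`-regular sequences
with entries in the graded maximal ideal `(x_v : v ∈ σ)`. -/
noncomputable def moduleDepth (K : Type u) [Field K] (σ : Type) (M : Type u) [AddCommGroup M]
    [Module (MvPolynomial σ K) M] : ℕ∞ :=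
  ⨆ (rs : List (MvPolynomial σ K))
    (_ : (∀ f ∈ rs, f ∈ Ideal.span (Set.range (X : σ → MvPolynomial σ K))) ∧
      RingTheory.Sequence.IsRegular M rs), (rs.length : ℕ∞)

/-- The Hilbert depth of an `S`-module with grading `ℳ` (all graded pieces finite-dimensional):
the largest depth of a finitely generated graded `S`-module `N` with the same Hilbert series,
i.e. with `dim_K N_k = dim_K ℳ_k` for all `k ∈ ℤ`. -/
noncomputable def hdepth {K : Type u} [Field K] (σ : Type) {M : Type u} [AddCommGroup M]
    [Module K M] (ℳ : ℤ → Submodule K M) : ℕ∞ :=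
  sSup {e : ℕ∞ | ∃ (N : Type u) (_ : AddCommGroup N) (_ : Module K N)
    (_ : Module (MvPolynomial σ K) N) (_ : IsScalarTower K (MvPolynomial σ K) N)
    (𝒩 : ℤ → Submodule K N),
      Module.Finite (MvPolynomial σ K) N ∧ IsGrading (σ := σ) 𝒩 ∧
      (∀ k : ℤ, Module.finrank K (𝒩 k) = Module.finrank K (ℳ k)) ∧
      e = moduleDepth K σ N}

/-- The grading of an ideal `I` of `S` by the subspaces `I ∩ S_k`. -/
noncomputable def idealGrading {K : Type u} [Field K] {σ : Type}
    (I : Ideal (MvPolynomial σ K)) (k : ℤ) : Submodule K I :=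
  (stdGrading K σ k).comap (I.subtype.restrictScalars K)

/-- The grading of `S/I` by the images of the `S_k`. -/
noncomputable def quotientGrading {K : Type u} [Field K] {σ : Type}
    (I : Ideal (MvPolynomial σ K)) (k : ℤ) : Submodule K (MvPolynomial σ K ⧸ I) :=
  (stdGrading K σ k).map (Ideal.Quotient.mkₐ K I).toLinearMap

/-- The ideal `I_{n_1,…,n_r}`: the variables come in `r` disjoint blocks, the `i`-th one being
`x_⟨i,0⟩, …, x_⟨i,n_i-1⟩`, and the ideal is the intersection of the `r` prime ideals generated by
the blocks. -/
noncomputable def blockIdeal (K : Type u) [Field K] {r : ℕ} (n : Fin r → ℕ) :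
    Ideal (MvPolynomial (Σ i : Fin r, Fin (n i)) K) :=
  ⨅ i : Fin r, Ideal.span (Set.range fun j : Fin (n i) => X ⟨i, j⟩)

/-- The sum `∑_J (-1)^|J| C(N - ∑_{i ∈ J} n_i - d + k - 1, k)` over all `J ⊆ {1,…,r}`, where
`N = n_1 + ⋯ + n_r` and `C(x,k) = x(x-1)⋯(x-k+1)/k!` for every integer `x`. -/
def idealSum {r : ℕ} (n : Fin r → ℕ) (d k : ℕ) : ℤ :=
  ∑ J : Finset (Fin r), (-1) ^ J.card *
    Ring.choose ((∑ i, (n i : ℤ)) - (∑ i ∈ J, (n i : ℤ)) - d + k - 1) k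

/-- The sum `∑_J (-1)^(|J|+1) C(N - ∑_{i ∈ J} n_i - d + k - 1, k)` over all nonempty
`J ⊆ {1,…,r}`. -/
def quotientSum {r : ℕ} (n : Fin r → ℕ) (d k : ℕ) : ℤ :=
  ∑ J : Finset (Fin r) with J.Nonempty, (-1) ^ (J.card + 1) *
    Ring.choose ((∑ i, (n i : ℤ)) - (∑ i ∈ J, (n i : ℤ)) - d + k - 1) k

end HilbertDepth

/-!
For the Hilbert series `H` of `I` or of `S/I`, the Hilbert depth is the largest `d` such that
`(1 - t)^d H` has nonnegative coefficients.

It is at most that: after base change to an infinite field, Rees' theorem allows the elements of a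
regular sequence of length `d` to be replaced one after the other by linear forms, and dividing by
a regular linear form multiplies the Hilbert series by `1 - t`. It is at least that: here
`(1 - t)^d H` is built from the series `(1 - t)^(-n_i)` and `(1 - t)^(-n_i) - 1`, and expanding
the latter as `∑_{1 ≤ j ≤ n_i} t (1 - t)^(-j)` shows that the part of `(1 - t)^d H` in degrees
above `d` is always a sum of series `t^s (1 - t)^(-j)` with `j ≤ N - d`. If the coefficients up to
degree `d` are nonnegative too, `H` is therefore the Hilbert series of a direct sum of shifted
polynomial rings in at least `d` variables.

The upper bounds on `d` come from the coefficient of `t^(r+1)` for `I`, and for `S/I` from the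
coefficient of `t^d` in `(1 - t)^(d-1) H`, which vanishes for `d > N - min n_i` but is at least `1`
if `(1 - t)^d H` has nonnegative coefficients. The lower bounds come from the nonnegativity of
`(1 - t)^(-⌊n_i/2⌋) - (1 - t)^⌈n_i/2⌉`.
-/

namespace HilbertDepth

open scoped PowerSeries

section PowerSeries

/-- The power series `(1 - X)^(-x)` for an integer `x`. -/
noncomputable def negPow (x : ℤ) : ℤ⟦X⟧ :=
  PowerSeries.rescale (-1) (PowerSeries.binomialSeries ℤ (-x))

@[simp] lemma coeff_negPow (x : ℤ) (k : ℕ) :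
    PowerSeries.coeff k (negPow x) = Ring.multichoose x k := by
  rw [negPow, PowerSeries.coeff_rescale, PowerSeries.binomialSeries_coeff, Ring.choose_neg,
    ← Ring.multichoose_eq, Int.negOnePow_def, zpow_natCast, Units.smul_def]
  rcases Nat.even_or_odd k with hk | hk <;> simp [hk]

@[simp] lemma negPow_zero : negPow 0 = 1 := by simp [negPow]

lemma negPow_add (x y : ℤ) : negPow (x + y) = negPow x * negPow y := by
  simp [negPow, add_comm]

lemma negPow_sum {ι : Type*} (T : Finset ι) (f : ι → ℤ) :
    negPow (∑ i ∈ T, f i) = ∏ i ∈ T, negPow (f i) := by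
  classical
  induction T using Finset.induction_on with
  | empty => simp
  | insert a s ha ih => rw [Finset.sum_insert ha, Finset.prod_insert ha, negPow_add, ih]

lemma negPow_neg_natCast (n : ℕ) : negPow (-n) = (1 - PowerSeries.X) ^ n := by
  simp [negPow, sub_eq_add_neg]

lemma negPow_add_one (x : ℤ) : negPow (x + 1) = negPow x + PowerSeries.X * negPow (x + 1) := by
  have h : negPow x = negPow (x + 1) * (1 - PowerSeries.X) := by
    rw [← pow_one (1 - PowerSeries.X), ← negPow_neg_natCast, ← negPow_add]
    simp
  linear_combination -h

lemma negPow_natCast_sub_one (n : ℕ) :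
    negPow n - 1 = PowerSeries.X * ∑ j ∈ Finset.range n, negPow (j + 1) := by
  have telescope (j : ℕ) :
      PowerSeries.X * negPow ((j : ℤ) + 1) = negPow ((j + 1 : ℕ) : ℤ) - negPow j := by
    push_cast
    linear_combination -negPow_add_one j
  simp_rw [Finset.mul_sum, telescope, Finset.sum_range_sub (fun j => negPow (j : ℤ))]
  simp

lemma multichoose_neg_natCast (n k : ℕ) :
    Ring.multichoose (-n : ℤ) k = (-1) ^ k * (n.choose k : ℤ) := by
  have h := Ring.choose_neg (-n : ℤ) k
  rw [neg_neg, Ring.choose_natCast] at h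
  rw [Ring.multichoose_eq, h, Int.negOnePow_def]
  rcases Nat.even_or_odd k with hk | hk <;> simp [hk]

lemma multichoose_natCast (n k : ℕ) :
    Ring.multichoose (n : ℤ) k = (n.multichoose k : ℤ) := by
  cases n with
  | zero => cases k <;> simp
  | succ n =>
    rw [Ring.multichoose_eq, Nat.multichoose_eq, ← Ring.choose_natCast]
    congr 1
    push_cast [show n + 1 + k - 1 = n + k by omega]
    ring

/-- The semiring of integral power series with nonnegative coefficients. -/
def nonnegSeries : Subsemiring ℤ⟦X⟧ where
  carrier := {φ | ∀ k, 0 ≤ PowerSeries.coeff k φ}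
  zero_mem' := by simp
  one_mem' k := by rw [PowerSeries.coeff_one]; split_ifs <;> simp
  add_mem' ha hb k := by simpa using add_nonneg (ha k) (hb k)
  mul_mem' ha hb k := by
    rw [PowerSeries.coeff_mul]
    exact Finset.sum_nonneg fun p _ => mul_nonneg (ha _) (hb _)

lemma negPow_natCast_mem (n : ℕ) : negPow n ∈ nonnegSeries := fun k => by
  simp [multichoose_natCast]

/-- The series that are finite sums of series `X^s (1 - X)^(-j)` with `j ≤ m`; these are the
Hilbert series of the direct sums of shifted polynomial rings in at most `m` variables. -/
noncomputable def decomposable (m : ℕ) : AddSubmonoid ℤ⟦X⟧ :=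
  AddSubmonoid.closure {φ | ∃ s j : ℕ, j ≤ m ∧ φ = PowerSeries.X ^ s * negPow j}

lemma X_pow_mul_negPow_mem {m j : ℕ} (s : ℕ) (h : j ≤ m) :
    PowerSeries.X ^ s * negPow j ∈ decomposable m :=
  AddSubmonoid.subset_closure ⟨s, j, h, rfl⟩

lemma X_pow_mem_decomposable (m s : ℕ) : PowerSeries.X ^ s ∈ decomposable m := by
  simpa using X_pow_mul_negPow_mem s (Nat.zero_le m)

/-- The part of a power series in degrees at least `L`. -/
noncomputable def tail (L : ℕ) : ℤ⟦X⟧ →+ ℤ⟦X⟧ where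
  toFun φ := PowerSeries.mk fun k => if k < L then 0 else PowerSeries.coeff k φ
  map_zero' := by ext; simp
  map_add' a b := by ext k; simp only [PowerSeries.coeff_mk, map_add]; split_ifs <;> simp

lemma coeff_tail (L k : ℕ) (φ : ℤ⟦X⟧) :
    PowerSeries.coeff k (tail L φ) = if k < L then 0 else PowerSeries.coeff k φ := by
  simp [tail]

lemma tail_eq_zero {L : ℕ} {φ : ℤ⟦X⟧} (h : ∀ k, L ≤ k → PowerSeries.coeff k φ = 0) :
    tail L φ = 0 := by
  ext k
  rw [coeff_tail]
  split_ifs with hk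
  · simp
  · simp [h k (not_lt.1 hk)]

lemma tail_X_pow_mul {L s : ℕ} (h : L ≤ s) (φ : ℤ⟦X⟧) :
    tail L (PowerSeries.X ^ s * φ) = PowerSeries.X ^ s * φ := by
  ext k
  rw [coeff_tail, PowerSeries.coeff_X_pow_mul']
  grind

lemma tail_X_pow {L s : ℕ} (h : s < L) : tail L (PowerSeries.X ^ s) = 0 :=
  tail_eq_zero fun k hk => by simp [PowerSeries.coeff_X_pow, (h.trans_le hk).ne']

lemma eq_sum_add_tail (L : ℕ) (φ : ℤ⟦X⟧) :
    φ = ∑ k ∈ Finset.range L, PowerSeries.coeff k φ • PowerSeries.X ^ k + tail L φ := by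
  ext k
  simp only [map_add, map_sum, map_zsmul, PowerSeries.coeff_X_pow, coeff_tail, smul_eq_mul,
    mul_ite, mul_one, mul_zero, Finset.sum_ite_eq, Finset.mem_range]
  split_ifs <;> simp

lemma tail_X_pow_mul_negPow_natCast_mem {m j : ℕ} (L s : ℕ) (hj : j ≤ m) :
    tail L (PowerSeries.X ^ s * negPow j) ∈ decomposable m := by
  induction h : L - s generalizing s j with
  | zero =>
    rw [tail_X_pow_mul (by omega)]
    exact X_pow_mul_negPow_mem s hj
  | succ t ih =>
    have expand : PowerSeries.X ^ s * negPow j = PowerSeries.X ^ s +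
        ∑ i ∈ Finset.range j, PowerSeries.X ^ (s + 1) * negPow ((i + 1 : ℕ) : ℤ) := by
      push_cast
      rw [← Finset.mul_sum]
      linear_combination PowerSeries.X ^ s * negPow_natCast_sub_one j
    rw [expand, map_add, map_sum, tail_X_pow (by omega), zero_add]
    exact sum_mem fun i hi => ih (s + 1) (by grind) (by omega)

lemma tail_X_pow_mul_negPow_mem {m L s : ℕ} {e : ℤ} (he : e ≤ m) (hs : s - e < L) :
    tail L (PowerSeries.X ^ s * negPow e) ∈ decomposable m := by
  obtain ⟨j, rfl | rfl⟩ := e.eq_nat_or_neg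
  · exact tail_X_pow_mul_negPow_natCast_mem L s (by exact_mod_cast he)
  · rw [tail_eq_zero fun k hk => ?_]
    · exact zero_mem _
    · rw [PowerSeries.coeff_X_pow_mul', if_pos (by omega), coeff_negPow,
        Ring.multichoose_neg_of_lt _ _ (by omega)]

lemma mem_decomposable_of_tail {m L : ℕ} {φ : ℤ⟦X⟧}
    (h : ∀ k < L, 0 ≤ PowerSeries.coeff k φ) (ht : tail L φ ∈ decomposable m) :
    φ ∈ decomposable m := by
  rw [eq_sum_add_tail L φ]
  refine add_mem (sum_mem fun k hk => ?_) ht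
  rw [← Int.toNat_of_nonneg (h k (Finset.mem_range.1 hk)), natCast_zsmul]
  exact nsmul_mem (X_pow_mem_decomposable m k) _

end PowerSeries

section HilbertSeries

variable {ι : Type*} (n : ι → ℕ)

lemma tail_mul_prod_negPow_sub_one_mem {m L : ℕ} (T : Finset ι) (s : ℕ) (e : ℤ)
    (he : e + ∑ i ∈ T, (n i : ℤ) ≤ m) (hs : s - e < L) :
    tail L (PowerSeries.X ^ s * negPow e * ∏ i ∈ T, (negPow (n i) - 1)) ∈ decomposable m := by
  classical
  induction T using Finset.induction_on generalizing s e with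
  | empty => simpa using tail_X_pow_mul_negPow_mem (by simpa using he) hs
  | insert a T ha ih =>
    rw [Finset.sum_insert ha] at he
    have expand : PowerSeries.X ^ s * negPow e * ∏ i ∈ insert a T, (negPow (n i) - 1)
        = ∑ j ∈ Finset.range (n a), PowerSeries.X ^ (s + 1) * negPow (e + (j + 1))
          * ∏ i ∈ T, (negPow (n i) - 1) := by
      simp only [Finset.prod_insert ha, negPow_natCast_sub_one (n a), Finset.sum_mul,
        Finset.mul_sum]
      refine Finset.sum_congr rfl fun j _ => ?_
      rw [negPow_add e]
      ring
    rw [expand, map_sum]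
    refine sum_mem fun j hj => ih _ _ ?_ ?_
    · have := Finset.mem_range.1 hj
      omega
    · push_cast
      omega

lemma tail_mul_prod_negPow_sub_prod_mem {m L : ℕ} (T : Finset ι) (s : ℕ) (e : ℤ)
    (he : e + ∑ i ∈ T, (n i : ℤ) ≤ m) (hs : s - e < L) :
    tail L (PowerSeries.X ^ s * negPow e *
      (∏ i ∈ T, negPow (n i) - ∏ i ∈ T, (negPow (n i) - 1))) ∈ decomposable m := by
  classical
  induction T using Finset.induction_on generalizing s e with
  | empty => simp
  | insert a T ha ih =>
    rw [Finset.sum_insert ha] at he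
    have split : PowerSeries.X ^ s * negPow e *
        (∏ i ∈ insert a T, negPow (n i) - ∏ i ∈ insert a T, (negPow (n i) - 1))
        = PowerSeries.X ^ s * negPow (e + n a) *
          (∏ i ∈ T, negPow (n i) - ∏ i ∈ T, (negPow (n i) - 1))
          + PowerSeries.X ^ s * negPow e * ∏ i ∈ T, (negPow (n i) - 1) := by
      rw [Finset.prod_insert ha, Finset.prod_insert ha, negPow_add e]
      ring
    rw [split, map_add]
    exact add_mem (ih _ _ (by omega) (by omega))
      (tail_mul_prod_negPow_sub_one_mem n T _ _ (by omega) hs)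

variable [Fintype ι]

/-- The Hilbert series of the intersection of the prime ideals generated by disjoint blocks of
`n i` variables. -/
noncomputable def idealSeries : ℤ⟦X⟧ := ∏ i, (negPow (n i) - 1)

/-- The Hilbert series of the quotient of the polynomial ring by the intersection of the prime
ideals generated by disjoint blocks of `n i` variables. -/
noncomputable def quotientSeries : ℤ⟦X⟧ := ∏ i, negPow (n i) - idealSeries n

lemma idealSeries_eq_sum :
    idealSeries n = ∑ J : Finset ι,
      (-1) ^ J.card * negPow (∑ i, (n i : ℤ) - ∑ i ∈ J, (n i : ℤ)) := by
  classical
  simp only [idealSeries, sub_eq_neg_add (negPow _), Finset.prod_add, Finset.powerset_univ]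
  refine Finset.sum_congr rfl fun J _ => ?_
  rw [Finset.prod_const, ← negPow_sum, ← Finset.sum_sdiff (Finset.subset_univ J),
    add_sub_cancel_right]

lemma quotientSeries_eq_sum :
    quotientSeries n = ∑ J : Finset ι with J.Nonempty,
      (-1) ^ (J.card + 1) * negPow (∑ i, (n i : ℤ) - ∑ i ∈ J, (n i : ℤ)) := by
  classical
  have hempty : (Finset.univ.filter fun J : Finset ι => ¬ J.Nonempty) = {∅} := by
    ext J
    simp
  rw [quotientSeries, idealSeries_eq_sum, ← Finset.sum_filter_add_sum_filter_not _ Finset.Nonempty,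
    hempty]
  simp [negPow_sum, pow_succ]

lemma idealSeries_eq_X_pow_mul :
    idealSeries n = PowerSeries.X ^ Fintype.card ι *
      ∏ i, ∑ j ∈ Finset.range (n i), negPow (j + 1) := by
  simp [idealSeries, negPow_natCast_sub_one, Finset.prod_mul_distrib]

end HilbertSeries

section Coefficients

variable {r : ℕ} (n : Fin r → ℕ)

lemma coeff_negPow_mul_sum_negPow {α : Type*} (s : Finset α) (c : α → ℕ) (f : α → ℤ) (d k : ℕ) :
    PowerSeries.coeff k (negPow (-d) * ∑ a ∈ s, (-1) ^ c a * negPow (f a)) =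
      ∑ a ∈ s, (-1) ^ c a * Ring.choose (f a - d + k - 1) k := by
  rw [Finset.mul_sum, map_sum]
  refine Finset.sum_congr rfl fun a _ => ?_
  rw [mul_left_comm, ← negPow_add, neg_add_eq_sub, ← Ring.multichoose_eq, ← coeff_negPow]
  rcases Nat.even_or_odd (c a) with h | h <;> simp [h.neg_one_pow]

lemma coeff_negPow_mul_idealSeries (d k : ℕ) :
    PowerSeries.coeff k (negPow (-d) * idealSeries n) = idealSum n d k := by
  rw [idealSeries_eq_sum, coeff_negPow_mul_sum_negPow, idealSum]

lemma coeff_negPow_mul_quotientSeries (d k : ℕ) :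
    PowerSeries.coeff k (negPow (-d) * quotientSeries n) = quotientSum n d k := by
  rw [quotientSeries_eq_sum, coeff_negPow_mul_sum_negPow, quotientSum]

lemma idealSum_eq_zero {d k : ℕ} (hk : k < r) : idealSum n d k = 0 := by
  rw [← coeff_negPow_mul_idealSeries, idealSeries_eq_X_pow_mul, mul_left_comm,
    PowerSeries.coeff_X_pow_mul', if_neg (by simpa using hk)]

lemma quotientSum_nonneg_of_lt {d k : ℕ} (hd : d ≤ ∑ i, n i) (hk : k < r) :
    0 ≤ quotientSum n d k := by
  rw [← coeff_negPow_mul_quotientSeries, quotientSeries, mul_sub, map_sub,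
    coeff_negPow_mul_idealSeries, idealSum_eq_zero n hk, sub_zero, ← negPow_sum, ← negPow_add,
    neg_add_eq_sub, ← Nat.cast_sum, ← Nat.cast_sub hd]
  exact negPow_natCast_mem _ k

lemma negPow_mul_idealSeries_mem_decomposable {d : ℕ} (hd : d ≤ ∑ i, n i)
    (h : ∀ k ≤ d, 0 ≤ idealSum n d k) :
    negPow (-d) * idealSeries n ∈ decomposable (∑ i, n i - d) := by
  refine mem_decomposable_of_tail (L := d + 1) (fun k hk => ?_) ?_
  · rw [coeff_negPow_mul_idealSeries]
    exact h k (by omega)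
  · simpa [idealSeries] using tail_mul_prod_negPow_sub_one_mem n (m := ∑ i, n i - d)
      (L := d + 1) Finset.univ 0 (-d) (by push_cast [hd]; omega) (by push_cast; omega)

lemma negPow_mul_quotientSeries_mem_decomposable {d : ℕ} (hd : d ≤ ∑ i, n i)
    (h : ∀ k ≤ d, 0 ≤ quotientSum n d k) :
    negPow (-d) * quotientSeries n ∈ decomposable (∑ i, n i - d) := by
  refine mem_decomposable_of_tail (L := d + 1) (fun k hk => ?_) ?_
  · rw [coeff_negPow_mul_quotientSeries]
    exact h k (by omega)
  · simpa [quotientSeries, idealSeries] using tail_mul_prod_negPow_sub_prod_mem n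
      (m := ∑ i, n i - d) (L := d + 1) Finset.univ 0 (-d) (by push_cast [hd]; omega)
      (by push_cast; omega)

end Coefficients

section UpperBounds

lemma coeff_zero_sum_negPow (n : ℕ) :
    PowerSeries.coeff 0 (∑ j ∈ Finset.range n, negPow (j + 1)) = n := by
  simp only [map_sum, coeff_negPow, Ring.multichoose_zero_right]
  simp

lemma two_mul_coeff_one_sum_negPow (n : ℕ) :
    2 * PowerSeries.coeff 1 (∑ j ∈ Finset.range n, negPow (j + 1)) = n * (n + 1) := by
  simp only [map_sum, coeff_negPow, Ring.multichoose_one_right]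
  induction n with
  | zero => simp
  | succ n ih =>
    rw [Finset.sum_range_succ, mul_add, ih]
    push_cast
    ring

lemma coeff_zero_prod_sum_negPow {ι : Type*} (n : ι → ℕ) (T : Finset ι) :
    PowerSeries.coeff 0 (∏ i ∈ T, ∑ j ∈ Finset.range (n i), negPow (j + 1)) =
      ∏ i ∈ T, (n i : ℤ) := by
  rw [PowerSeries.coeff_zero_eq_constantCoeff_apply, map_prod]
  refine Finset.prod_congr rfl fun i _ => ?_
  rw [← PowerSeries.coeff_zero_eq_constantCoeff_apply, coeff_zero_sum_negPow]

lemma two_mul_coeff_one_prod_sum_negPow {ι : Type*} (n : ι → ℕ) (T : Finset ι) :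
    2 * PowerSeries.coeff 1 (∏ i ∈ T, ∑ j ∈ Finset.range (n i), negPow (j + 1)) =
      (∏ i ∈ T, (n i : ℤ)) * ∑ i ∈ T, ((n i : ℤ) + 1) := by
  classical
  induction T using Finset.induction_on with
  | empty => simp [PowerSeries.coeff_one]
  | insert a T ha ih =>
    rw [Finset.prod_insert ha, PowerSeries.coeff_one_mul,
      ← PowerSeries.coeff_zero_eq_constantCoeff_apply,
      ← PowerSeries.coeff_zero_eq_constantCoeff_apply, coeff_zero_sum_negPow,
      coeff_zero_prod_sum_negPow, Finset.prod_insert ha, Finset.sum_insert ha]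
    linear_combination (∏ i ∈ T, (n i : ℤ)) * two_mul_coeff_one_sum_negPow (n a) + (n a : ℤ) * ih

variable {r : ℕ} (n : Fin r → ℕ)

lemma two_mul_idealSum_succ (d : ℕ) :
    2 * idealSum n d (r + 1) = (∏ i, (n i : ℤ)) * (∑ i, (n i : ℤ) + r - 2 * d) := by
  have hsum := two_mul_coeff_one_prod_sum_negPow n Finset.univ
  rw [Finset.sum_add_distrib, Finset.sum_const, Finset.card_univ, Fintype.card_fin,
    nsmul_eq_mul, mul_one] at hsum
  rw [← coeff_negPow_mul_idealSeries, idealSeries_eq_X_pow_mul, mul_left_comm, Fintype.card_fin,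
    add_comm r, PowerSeries.coeff_X_pow_mul, PowerSeries.coeff_one_mul,
    ← PowerSeries.coeff_zero_eq_constantCoeff_apply,
    ← PowerSeries.coeff_zero_eq_constantCoeff_apply, coeff_negPow, coeff_negPow,
    coeff_zero_prod_sum_negPow, Ring.multichoose_one_right, Ring.multichoose_zero_right]
  linear_combination hsum

lemma le_of_idealSeries_nonneg (hn : ∀ i, 1 ≤ n i) {d : ℕ}
    (h : negPow (-d) * idealSeries n ∈ nonnegSeries) : d ≤ (∑ i, n i + r) / 2 := by
  have hcoeff := h (r + 1)
  rw [coeff_negPow_mul_idealSeries] at hcoeff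
  have hprod : 0 < ∏ i, (n i : ℤ) := Finset.prod_pos fun i _ => by exact_mod_cast hn i
  have hle : 0 ≤ ∑ i, (n i : ℤ) + r - 2 * d :=
    nonneg_of_mul_nonneg_right (by linarith [two_mul_idealSum_succ n d]) hprod
  zify at hle ⊢
  omega

lemma coeff_zero_le_coeff_mul_negPow_one {φ : ℤ⟦X⟧} (h : φ ∈ nonnegSeries) (k : ℕ) :
    PowerSeries.coeff 0 φ ≤ PowerSeries.coeff k (φ * negPow 1) := by
  have hmem : ((0, k) : ℕ × ℕ) ∈ Finset.HasAntidiagonal.antidiagonal k := by simp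
  rw [PowerSeries.coeff_mul]
  refine le_trans ?_ (Finset.single_le_sum
    (fun p _ => mul_nonneg (h p.1) (negPow_natCast_mem 1 p.2)) hmem)
  simp

lemma coeff_zero_negPow_mul_quotientSeries [NeZero r] (x : ℤ) :
    PowerSeries.coeff 0 (negPow x * quotientSeries n) = 1 := by
  have hconst (y : ℤ) : PowerSeries.constantCoeff (negPow y) = 1 := by
    rw [← PowerSeries.coeff_zero_eq_constantCoeff_apply, coeff_negPow,
      Ring.multichoose_zero_right]
  simp [quotientSeries, idealSeries, hconst, NeZero.ne r]

lemma quotientSum_succ_eq_zero {e m : ℕ} (hm : ∀ i, m ≤ n i) (he : ∑ i, n i ≤ e + m) :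
    quotientSum n e (e + 1) = 0 := by
  refine Finset.sum_eq_zero fun J hJ => ?_
  obtain ⟨i, hi⟩ := (Finset.mem_filter.1 hJ).2
  have hmJ : m ≤ ∑ i ∈ J, n i := (hm i).trans (Finset.single_le_sum (by simp) hi)
  have hJN : ∑ i ∈ J, n i ≤ ∑ i, n i := Finset.sum_le_univ_sum_of_nonneg (by simp)
  obtain ⟨a, ha⟩ : ∃ a : ℕ, (∑ i, (n i : ℤ)) - (∑ i ∈ J, (n i : ℤ)) - e = -(a : ℤ) :=
    ⟨e + ∑ i ∈ J, n i - ∑ i, n i, by push_cast [show ∑ i, n i ≤ e + ∑ i ∈ J, n i by omega]; ring⟩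
  rw [← Ring.multichoose_eq, ha, Ring.multichoose_neg_of_lt _ _ (by zify at *; omega), mul_zero]

lemma le_of_quotientSeries_nonneg [NeZero r] {d m : ℕ} (hm : ∀ i, m ≤ n i)
    (h : negPow (-d) * quotientSeries n ∈ nonnegSeries) : d ≤ ∑ i, n i - m := by
  by_contra! hlt
  obtain ⟨e, rfl⟩ : ∃ e, d = e + 1 := ⟨d - 1, by omega⟩
  have hpos := coeff_zero_le_coeff_mul_negPow_one h (e + 1)
  have hshift : negPow (-(e + 1 : ℕ)) * quotientSeries n * negPow 1
      = negPow (-e) * quotientSeries n := by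
    rw [mul_right_comm, ← negPow_add]
    congr 2
    push_cast
    ring
  rw [coeff_zero_negPow_mul_quotientSeries, hshift, coeff_negPow_mul_quotientSeries,
    quotientSum_succ_eq_zero n hm (by omega)] at hpos
  exact absurd hpos (by norm_num)

end UpperBounds

section LowerBounds

lemma choose_le_multichoose {a b k : ℕ} (h : b ≤ a + 1) (hk : 2 ≤ k) :
    b.choose k ≤ a.multichoose k := by
  rw [Nat.multichoose_eq]
  exact Nat.choose_le_choose k (by omega)

lemma negPow_sub_negPow_neg_mem {a b : ℕ} (h : b ≤ a + 1) :
    negPow a - negPow (-b) ∈ nonnegSeries := by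
  intro k
  rw [map_sub, coeff_negPow, coeff_negPow]
  match k with
  | 0 => simp
  | 1 => simp only [Ring.multichoose_one_right]; omega
  | k + 2 =>
    rw [multichoose_natCast, multichoose_neg_natCast]
    have h1 := choose_le_multichoose (k := k + 2) h (by omega)
    rcases neg_one_pow_eq_or ℤ (k + 2) with h2 | h2 <;> rw [h2] <;> omega

lemma negPow_add_negPow_sub_mem {a b c : ℕ} (h : b ≤ a + 1) :
    negPow a + negPow (c - b) - negPow (-b) ∈ nonnegSeries := by
  rcases le_total b c with hbc | hbc
  · rw [add_sub_right_comm, ← Nat.cast_sub hbc]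
    exact add_mem (negPow_sub_negPow_neg_mem h) (negPow_natCast_mem _)
  intro k
  rw [show (c : ℤ) - b = -((b - c : ℕ) : ℤ) by push_cast [hbc]; ring, map_sub, map_add,
    coeff_negPow, coeff_negPow, coeff_negPow]
  match k with
  | 0 => simp
  | 1 => simp only [Ring.multichoose_one_right]; omega
  | k + 2 =>
    rw [multichoose_natCast, multichoose_neg_natCast, multichoose_neg_natCast]
    have h1 := choose_le_multichoose (k := k + 2) h (by omega)
    have h2 := Nat.choose_le_choose (k + 2) (show b - c ≤ b by omega)
    rcases neg_one_pow_eq_or ℤ (k + 2) with h3 | h3 <;> rw [h3] <;> omega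

lemma mul_prod_sub_mul_prod_sub_mem {R ι : Type*} [CommRing R] {P : Subsemiring R}
    {A B : ι → R} {E D : R} {T : Finset ι} (hA : ∀ i ∈ T, A i ∈ P)
    (hAB : ∀ i ∈ T, A i - B i ∈ P) (hEB : ∀ i ∈ T, E * B i ∈ P) (hED : E - D ∈ P) :
    E * ∏ i ∈ T, A i - D * ∏ i ∈ T, (A i - B i) ∈ P := by
  classical
  induction T using Finset.induction_on with
  | empty => simpa using hED
  | insert a T ha ih =>
    rw [Finset.forall_mem_insert] at hA hAB hEB
    have peel : E * ∏ i ∈ insert a T, A i - D * ∏ i ∈ insert a T, (A i - B i) =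
        (A a - B a) * (E * ∏ i ∈ T, A i - D * ∏ i ∈ T, (A i - B i)) +
          E * B a * ∏ i ∈ T, A i := by
      rw [Finset.prod_insert ha, Finset.prod_insert ha]
      ring
    rw [peel]
    exact add_mem (mul_mem hAB.1 (ih hA.2 hAB.2 hEB.2)) (mul_mem hEB.1 (prod_mem hA.2))

lemma negPow_mul_prod_sub_mem {ι : Type*} {a b : ι → ℕ} (hab : ∀ i, b i ≤ a i + 1)
    {c : ℕ} (hc : 1 ≤ c) (T : Finset ι) :
    negPow c * ∏ i ∈ T, negPow (a i)
      - (negPow c - 1) * ∏ i ∈ T, (negPow (a i) - negPow (-b i)) ∈ nonnegSeries := by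
  classical
  rcases T.eq_empty_or_nonempty with rfl | hT
  · simp
  -- The largest `b m` is split off, so that `negPow (c + a m)` absorbs every other `b i`.
  obtain ⟨m, hm, hmax⟩ := T.exists_max_image b hT
  rw [← Finset.mul_prod_erase T _ hm, ← Finset.mul_prod_erase T _ hm, ← mul_assoc, ← mul_assoc]
  refine mul_prod_sub_mul_prod_sub_mem (fun i _ => negPow_natCast_mem _)
    (fun i _ => negPow_sub_negPow_neg_mem (hab i)) (fun i hi => ?_) ?_
  · have hle : b i ≤ c + a m := by
      have := hmax i (Finset.mem_of_mem_erase hi)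
      have := hab m
      omega
    rw [← negPow_add, ← negPow_add, ← Nat.cast_add, ← sub_eq_add_neg, ← Nat.cast_sub hle]
    exact negPow_natCast_mem _
  · convert negPow_add_negPow_sub_mem (c := c) (hab m) using 1
    rw [sub_eq_add_neg (c : ℤ), negPow_add]
    ring

variable {ι : Type*} (n : ι → ℕ)

lemma prod_negPow_half (T : Finset ι) :
    ∏ i ∈ T, negPow (n i / 2 : ℕ) =
      negPow (-(∑ i ∈ T, (n i + 1) / 2 : ℕ)) * ∏ i ∈ T, negPow (n i) := by
  rw [← negPow_sum, ← negPow_sum, ← negPow_add, Nat.cast_sum, neg_add_eq_sub,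
    ← Finset.sum_sub_distrib]
  exact congrArg negPow (Finset.sum_congr rfl fun i _ => by omega)

lemma prod_negPow_half_sub (T : Finset ι) :
    ∏ i ∈ T, (negPow (n i / 2 : ℕ) - negPow (-((n i + 1) / 2 : ℕ))) =
      negPow (-(∑ i ∈ T, (n i + 1) / 2 : ℕ)) * ∏ i ∈ T, (negPow (n i) - 1) := by
  rw [Nat.cast_sum, ← Finset.sum_neg_distrib, negPow_sum, ← Finset.prod_mul_distrib]
  refine Finset.prod_congr rfl fun i _ => ?_
  rw [mul_sub, mul_one, ← negPow_add]
  congr 2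
  omega

variable [Fintype ι]

lemma negPow_mul_idealSeries_nonneg :
    negPow (-(∑ i, (n i + 1) / 2 : ℕ)) * idealSeries n ∈ nonnegSeries := by
  rw [idealSeries, ← prod_negPow_half_sub]
  exact prod_mem fun i _ => negPow_sub_negPow_neg_mem (by omega)

lemma negPow_mul_quotientSeries_nonneg (j : ι) (hj : 1 ≤ n j) :
    negPow (-(∑ i, (n i + 1) / 2 - (n j + 1) / 2 : ℕ)) * quotientSeries n ∈ nonnegSeries := by
  classical
  have hsum : ∑ i, (n i + 1) / 2 - (n j + 1) / 2 = ∑ i ∈ Finset.univ.erase j, (n i + 1) / 2 := by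
    rw [← Finset.add_sum_erase _ _ (Finset.mem_univ j)]
    omega
  convert negPow_mul_prod_sub_mem (a := fun i => n i / 2) (b := fun i => (n i + 1) / 2)
    (fun i => by omega) hj (Finset.univ.erase j) using 1
  rw [hsum, prod_negPow_half, prod_negPow_half_sub, quotientSeries, idealSeries,
    ← Finset.mul_prod_erase _ _ (Finset.mem_univ j),
    ← Finset.mul_prod_erase _ _ (Finset.mem_univ j)]
  ring

end LowerBounds

section Monomials

variable {K : Type u} [Field K] {σ : Type}

/-- The graded vector space `ℳ` has Hilbert series `φ`; in particular it vanishes in negative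
degrees. -/
structure HasHilbertSeries {M : Type*} [AddCommGroup M] [Module K M] (ℳ : ℤ → Submodule K M)
    (φ : ℤ⟦X⟧) : Prop where
  finrank_natCast (k : ℕ) : (Module.finrank K (ℳ k) : ℤ) = PowerSeries.coeff k φ
  finrank_of_neg (k : ℤ) : k < 0 → Module.finrank K (ℳ k) = 0

lemma mem_stdGrading {k : ℤ} {f : MvPolynomial σ K} :
    f ∈ stdGrading K σ k ↔ ∀ m ∈ f.support, (m.degree : ℤ) = k := by
  have hweight (m : σ →₀ ℕ) : Finsupp.weight (fun _ : σ => (1 : ℤ)) m = (m.degree : ℤ) := by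
    simp [Finsupp.weight_apply, Finsupp.degree_apply, Finsupp.sum]
  simp only [mem_weightedHomogeneousSubmodule, IsWeightedHomogeneous, hweight, mem_support_iff]

lemma stdGrading_of_neg {k : ℤ} (hk : k < 0) : stdGrading K σ k = ⊥ := by
  refine eq_bot_iff.2 fun f hf => support_eq_empty.1 (Finset.eq_empty_iff_forall_notMem.2 ?_)
  intro m hm
  have := mem_stdGrading.1 hf m hm
  omega

lemma finrank_restrictSupport (s : Finset (σ →₀ ℕ)) :
    Module.finrank K (restrictSupport K (s : Set (σ →₀ ℕ))) = s.card := by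
  simp [Module.finrank_eq_nat_card_basis (basisRestrictSupport K (s : Set (σ →₀ ℕ)))]

lemma finrank_idealGrading_eq (I : Ideal (MvPolynomial σ K)) (k : ℤ) :
    Module.finrank K (idealGrading I k) =
      Module.finrank K (I.restrictScalars K ⊓ stdGrading K σ k : Submodule K _) := by
  rw [← Submodule.map_comap_subtype]
  exact (Submodule.finrank_map_subtype_eq (I.restrictScalars K) _).symm

section Fintype

variable [Fintype σ] [DecidableEq σ]

lemma mem_univ_finsuppAntidiag {k : ℕ} {m : σ →₀ ℕ} :
    m ∈ Finset.univ.finsuppAntidiag k ↔ m.degree = k := by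
  simp [Finset.mem_finsuppAntidiag, Finsupp.degree_eq_sum]

lemma stdGrading_natCast (k : ℕ) :
    stdGrading K σ k = restrictSupport K (Finset.univ.finsuppAntidiag k : Finset (σ →₀ ℕ)) := by
  ext f
  rw [mem_stdGrading, mem_restrictSupport_iff]
  simp only [Nat.cast_inj, Set.subset_def, Finset.mem_coe, mem_univ_finsuppAntidiag]

end Fintype

instance finite_stdGrading [Finite σ] (k : ℤ) : Module.Finite K (stdGrading K σ k) := by
  classical
  cases nonempty_fintype σ
  rcases lt_or_ge k 0 with hk | hk
  · rw [stdGrading_of_neg hk]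
    infer_instance
  · lift k to ℕ using hk
    rw [stdGrading_natCast]
    exact Module.Finite.of_basis (basisRestrictSupport K _)

lemma finrank_quotientGrading_add [Finite σ] (I : Ideal (MvPolynomial σ K)) (k : ℤ) :
    Module.finrank K (quotientGrading I k) + Module.finrank K (idealGrading I k) =
      Module.finrank K (stdGrading K σ k) := by
  let π := (Ideal.Quotient.mkₐ K I).toLinearMap
  have hker : LinearMap.ker π = I.restrictScalars K := by
    ext x
    exact Ideal.Quotient.eq_zero_iff_mem
  have hrank := (π.domRestrict (stdGrading K σ k)).finrank_range_add_finrank_ker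
  rwa [LinearMap.range_domRestrict, LinearMap.ker_domRestrict, hker,
    ← Submodule.finrank_map_subtype_eq, Submodule.map_comap_subtype, inf_comm,
    ← finrank_idealGrading_eq] at hrank

lemma hasHilbertSeries_stdGrading [Fintype σ] :
    HasHilbertSeries (stdGrading K σ) (negPow (Fintype.card σ)) where
  finrank_natCast k := by
    classical
    rw [stdGrading_natCast, finrank_restrictSupport,
      Finset.card_finsuppAntidiag_nat_eq_multichoose, coeff_negPow, multichoose_natCast,
      Finset.card_univ]
  finrank_of_neg k hk := by rw [stdGrading_of_neg hk, finrank_bot]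

end Monomials

section BlockIdeal

variable {K : Type u} [Field K] {r : ℕ} (n : Fin r → ℕ)

lemma mem_blockIdeal {f : MvPolynomial (Σ i : Fin r, Fin (n i)) K} :
    f ∈ blockIdeal K n ↔ ∀ m ∈ f.support, ∀ i, ∃ j, m ⟨i, j⟩ ≠ 0 := by
  have himage (i : Fin r) :
      (Set.range fun j : Fin (n i) => (X ⟨i, j⟩ : MvPolynomial (Σ i : Fin r, Fin (n i)) K))
        = X '' Set.range fun j : Fin (n i) => (⟨i, j⟩ : Σ i : Fin r, Fin (n i)) := by
    rw [← Set.range_comp]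
    rfl
  simp only [blockIdeal, Ideal.mem_iInf, himage, mem_ideal_span_X_image, Set.exists_range_iff]
  exact ⟨fun H m hm i => H i m hm, fun H i m hm => H m hm i⟩

lemma card_filter_forall_not {α ι : Type*} [Fintype ι] (s : Finset α) (P : ι → α → Prop)
    [DecidablePred fun a => ∀ i, ¬ P i a] [∀ J : Finset ι, DecidablePred fun a => ∀ i ∈ J, P i a] :
    ((s.filter fun a => ∀ i, ¬ P i a).card : ℤ) =
      ∑ J : Finset ι, (-1) ^ J.card * ((s.filter fun a => ∀ i ∈ J, P i a).card : ℤ) := by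
  classical
  have hindicator (a : α) : (if ∀ i, ¬ P i a then (1 : ℤ) else 0) =
      ∑ J : Finset ι, (-1) ^ J.card * if ∀ i ∈ J, P i a then 1 else 0 := by
    calc (if ∀ i, ¬ P i a then (1 : ℤ) else 0)
        = ∏ i, (1 + -if P i a then (1 : ℤ) else 0) := by
          have hfactor (i : ι) : (1 + -if P i a then (1 : ℤ) else 0) =
              if ¬ P i a then 1 else 0 := by
            split_ifs <;> simp_all
          simp only [hfactor, Finset.prod_ite_zero, Finset.prod_const_one, Finset.mem_univ,
            true_imp_iff]
      _ = _ := by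
          rw [Finset.prod_one_add, Finset.powerset_univ]
          refine Finset.sum_congr rfl fun J _ => ?_
          rw [Finset.prod_neg, Finset.prod_ite_zero, Finset.prod_const_one]
          congr
  simp only [Finset.card_filter, Nat.cast_sum, Nat.cast_ite, Nat.cast_one, Nat.cast_zero,
    hindicator, Finset.mul_sum]
  exact Finset.sum_comm

lemma filter_finsuppAntidiag_eq {ι : Type*} [Fintype ι] [DecidableEq ι] {κ : ι → Type*}
    [∀ i, Fintype (κ i)] [∀ i, DecidableEq (κ i)] (J : Finset ι)
    [DecidablePred fun m : (Σ i, κ i) →₀ ℕ => ∀ i ∈ J, ∀ j, m ⟨i, j⟩ = 0] (k : ℕ) :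
    ((Finset.univ.finsuppAntidiag k : Finset ((Σ i, κ i) →₀ ℕ)).filter
      fun m => ∀ i ∈ J, ∀ j, m ⟨i, j⟩ = 0) =
      (Jᶜ.sigma fun i => (Finset.univ : Finset (κ i))).finsuppAntidiag k := by
  ext m
  simp only [Finset.mem_filter, Finset.mem_finsuppAntidiag', Finset.subset_univ, and_true,
    and_congr_right_iff]
  refine fun _ => ⟨fun h ⟨i, j⟩ hm => ?_, fun h i hi j => ?_⟩
  · simp only [Finset.mem_sigma, Finset.mem_compl, Finset.mem_univ, and_true]
    exact fun hi => Finsupp.mem_support_iff.1 hm (h i hi j)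
  · by_contra hne
    simpa [hi] using h (Finsupp.mem_support_iff.2 hne)

lemma card_filter_finsuppAntidiag (k : ℕ) :
    (((Finset.univ.finsuppAntidiag k : Finset ((Σ i : Fin r, Fin (n i)) →₀ ℕ)).filter
      fun m => ∀ i, ¬ ∀ j, m ⟨i, j⟩ = 0).card : ℤ) = PowerSeries.coeff k (idealSeries n) := by
  rw [card_filter_forall_not _ fun (i : Fin r) (m : (Σ i : Fin r, Fin (n i)) →₀ ℕ) =>
    ∀ j, m ⟨i, j⟩ = 0, idealSeries_eq_sum, map_sum]
  refine Finset.sum_congr rfl fun J _ => ?_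
  have hcompl : (∑ i, (n i : ℤ)) - ∑ i ∈ J, (n i : ℤ) = ((∑ i ∈ Jᶜ, n i : ℕ) : ℤ) := by
    rw [← Finset.sum_add_sum_compl J]
    push_cast
    ring
  rw [filter_finsuppAntidiag_eq, Finset.card_finsuppAntidiag_nat_eq_multichoose,
    ← multichoose_natCast, Finset.card_sigma, hcompl]
  rcases Nat.even_or_odd J.card with h | h <;> simp [h.neg_one_pow]

lemma blockIdeal_inf_stdGrading (k : ℕ) :
    (blockIdeal K n).restrictScalars K ⊓ stdGrading K _ k = restrictSupport K
      ((Finset.univ.finsuppAntidiag k : Finset ((Σ i : Fin r, Fin (n i)) →₀ ℕ)).filter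
        fun m => ∀ i, ¬ ∀ j, m ⟨i, j⟩ = 0) := by
  ext f
  rw [Submodule.mem_inf, Submodule.restrictScalars_mem, mem_blockIdeal, mem_stdGrading,
    mem_restrictSupport_iff, Finset.coe_filter]
  simp only [mem_univ_finsuppAntidiag, Set.subset_def, Finset.mem_coe, Set.mem_ofPred_eq,
    Nat.cast_inj, not_forall, ← forall_and, and_comm]

lemma hasHilbertSeries_idealGrading_blockIdeal :
    HasHilbertSeries (idealGrading (blockIdeal K n)) (idealSeries n) where
  finrank_natCast k := by
    rw [finrank_idealGrading_eq, blockIdeal_inf_stdGrading, finrank_restrictSupport,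
      card_filter_finsuppAntidiag]
  finrank_of_neg k hk := by
    rw [finrank_idealGrading_eq, stdGrading_of_neg hk, inf_bot_eq, finrank_bot]

lemma hasHilbertSeries_quotientGrading_blockIdeal :
    HasHilbertSeries (quotientGrading (blockIdeal K n)) (quotientSeries n) where
  finrank_natCast k := by
    have h := finrank_quotientGrading_add (blockIdeal K n) (k : ℤ)
    zify at h
    rw [hasHilbertSeries_stdGrading.finrank_natCast,
      (hasHilbertSeries_idealGrading_blockIdeal n).finrank_natCast] at h
    rw [eq_sub_of_add_eq h, quotientSeries, map_sub, ← negPow_sum]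
    simp
  finrank_of_neg k hk := by
    rw [quotientGrading, stdGrading_of_neg hk, Submodule.map_bot, finrank_bot]

end BlockIdeal

section RegularSequences

open RingTheory.Sequence CategoryTheory Abelian Pointwise

variable {R : Type u} [CommRing R] {I : Ideal R} {M : Type u} [AddCommGroup M] [Module R M]

lemma smul_top_quotSMulTop_ne_top {y : R} (hy : y ∈ I) (hI : I • (⊤ : Submodule R M) ≠ ⊤) :
    I • (⊤ : Submodule R (QuotSMulTop y M)) ≠ ⊤ := by
  intro h
  have hcomap := congrArg (Submodule.comap (Submodule.mkQ _)) h
  rw [Submodule.comap_smul_top_of_surjective I _ (Submodule.mkQ_surjective _),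
    Submodule.ker_mkQ, Submodule.comap_top, sup_eq_left.2] at hcomap
  · exact hI hcomap
  · rw [← Submodule.ideal_span_singleton_smul]
    exact Submodule.smul_mono_left ((Ideal.span_singleton_le_iff_mem I).2 hy)

-- By Rees' theorem the existence of a regular sequence in `I` is detected by the vanishing of
-- `Ext (R ⧸ I) M`, and the long exact sequence of `0 → M → M → M ⧸ yM → 0` shifts it by one.
lemma exists_isRegular_quotSMulTop [IsNoetherianRing R] [Module.Finite R M]
    (hI : I • (⊤ : Submodule R M) ≠ ⊤) {y : R} (hy : y ∈ I) (hyM : IsSMulRegular M y)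
    {x : R} {rs : List R} (hmem : ∀ f ∈ x :: rs, f ∈ I) (hreg : IsRegular M (x :: rs)) :
    ∃ rs' : List R, rs'.length = rs.length ∧ (∀ f ∈ rs', f ∈ I) ∧
      IsRegular (QuotSMulTop y M) rs' := by
  have hsupp : Module.support R (R ⧸ I) = PrimeSpectrum.zeroLocus I := by
    rw [Module.support_eq_zeroLocus, Ideal.annihilator_quotient]
  have hext := ModuleCat.subsingleton_ext_of_exists_isRegular I (ModuleCat.of R (R ⧸ I))
    hsupp.subset (ModuleCat.of R M) hI.lt_top (x :: rs) hmem hreg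
  have hzero (j : ℕ) (hj : j < rs.length + 1) :=
    AddCommGrpCat.isZero_of_iff_subsingleton.2 (hext j hj)
  refine ModuleCat.exists_isRegular_of_exists_subsingleton_ext I rs.length
    (ModuleCat.of R (QuotSMulTop y M)) (smul_top_quotSMulTop_ne_top hy hI).lt_top
    (ModuleCat.of R (R ⧸ I)) hsupp fun i hi => ?_
  exact AddCommGrpCat.subsingleton_of_isZero <| ShortComplex.Exact.isZero_of_both_zeros
    (Ext.covariant_sequence_exact₃' (ModuleCat.of R (R ⧸ I))
      (IsSMulRegular.smulShortComplex_shortExact (M := ModuleCat.of R M) hyM) i (i + 1) rfl)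
    ((hzero i (by omega)).eq_zero_of_src _) ((hzero (i + 1) (by omega)).eq_zero_of_tgt _)

end RegularSequences

section LinearForms

variable {K : Type*} [Field K] {σ : Type}

lemma not_isSMulRegular_iff_exists_mem_associatedPrimes {R N : Type*} [CommRing R]
    [IsNoetherianRing R] [AddCommGroup N] [Module R N] {z : R} :
    ¬ IsSMulRegular N z ↔ ∃ p ∈ associatedPrimes R N, z ∈ p := by
  have h := Set.ext_iff.1 (biUnion_associatedPrimes_eq_compl_regular R N) z
  simpa using h.symm

/-- The linear form with the given coefficients. -/
noncomputable def linearForm [Fintype σ] : (σ → K) →ₗ[K] MvPolynomial σ K :=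
  Fintype.linearCombination K X

variable [Fintype σ]

lemma linearForm_apply (c : σ → K) :
    linearForm c = ∑ v, c v • (X v : MvPolynomial σ K) := by
  simp [linearForm, Fintype.linearCombination_apply]

lemma linearForm_mem (c : σ → K) :
    linearForm c ∈ Ideal.span (Set.range (X : σ → MvPolynomial σ K)) := by
  rw [linearForm_apply]
  refine sum_mem fun v _ => ?_
  rw [MvPolynomial.smul_eq_C_mul]
  exact Ideal.mul_mem_left _ _ (Ideal.subset_span ⟨v, rfl⟩)

-- The linear forms in an associated prime form a proper subspace, and over an infinite field
-- finitely many proper subspaces do not cover the space of all linear forms.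
lemma exists_isSMulRegular_linearForm [Infinite K] {N : Type*} [AddCommGroup N]
    [Module (MvPolynomial σ K) N] [Module.Finite (MvPolynomial σ K) N] {x : MvPolynomial σ K}
    (hx : x ∈ Ideal.span (Set.range (X : σ → MvPolynomial σ K))) (hreg : IsSMulRegular N x) :
    ∃ c : σ → K, IsSMulRegular N (linearForm c) := by
  classical
  by_contra! hcon
  have hfin := associatedPrimes.finite (MvPolynomial σ K) N
  let s : Finset (Subspace K (σ → K)) :=
    hfin.toFinset.image fun p => (p.restrictScalars K).comap linearForm
  have hs : ⊤ ∉ s := by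
    intro htop
    obtain ⟨p, hp, hpt⟩ := Finset.mem_image.1 htop
    refine not_isSMulRegular_iff_exists_mem_associatedPrimes.2
      ⟨p, hfin.mem_toFinset.1 hp, Ideal.span_le.2 ?_ hx⟩ hreg
    rintro _ ⟨v, rfl⟩
    have hv : Pi.single v (1 : K) ∈ (p.restrictScalars K).comap linearForm := by
      rw [hpt]
      exact Submodule.mem_top
    rw [Submodule.mem_comap, linearForm_apply] at hv
    simpa [Pi.single_apply] using hv
  refine Subspace.biUnion_ne_univ_of_top_notMem hs (Set.eq_univ_of_forall fun c => ?_)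
  obtain ⟨p, hp, hc⟩ := not_isSMulRegular_iff_exists_mem_associatedPrimes.1 (hcon c)
  exact Set.mem_biUnion (Finset.mem_image_of_mem _ (hfin.mem_toFinset.2 hp)) hc

end LinearForms

section ProjectionFamilies

open Pointwise

/-- The maps `p k` behave like the projections of a graded module, with finite-dimensional graded
pieces, onto its homogeneous components. Unlike gradings, such families are easily transported to
quotients and base changes. -/
structure IsProjectionFamily (K : Type*) [Field K] {σ : Type} {M : Type*} [AddCommGroup M]
    [Module K M] [Module (MvPolynomial σ K) M] (p : ℤ → M →ₗ[K] M) : Prop where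
  idem : ∀ k m, p k (p k m) = p k m
  X_smul : ∀ v k m, p (k + 1) ((X v : MvPolynomial σ K) • m) = (X v : MvPolynomial σ K) • p k m
  finite : ∀ k, Module.Finite K (LinearMap.range (p k))

namespace IsProjectionFamily

variable {K : Type u} [Field K] {σ : Type} {M : Type*} [AddCommGroup M] [Module K M]
  [Module (MvPolynomial σ K) M] {p : ℤ → M →ₗ[K] M}

lemma eq_zero_of_smul_top_eq_top (hp : IsProjectionFamily (σ := σ) K p) {φ : ℤ⟦X⟧}
    (hφ : HasHilbertSeries (fun k => LinearMap.range (p k)) φ)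
    (htop : Ideal.span (Set.range (X : σ → MvPolynomial σ K)) •
      (⊤ : Submodule (MvPolynomial σ K) M) = ⊤) (k : ℤ) : p k = 0 := by
  have hneg (k : ℤ) (hk : k < 0) : p k = 0 := by
    have := hp.finite k
    exact LinearMap.range_eq_bot.1 (Submodule.finrank_eq_zero.1 (hφ.finrank_of_neg k hk))
  have hsucc (k : ℤ) (hk : p k = 0) : p (k + 1) = 0 := by
    have hspan (f : MvPolynomial σ K) (hf : f ∈ Ideal.span (Set.range (X : σ → MvPolynomial σ K))) :
        ∀ m, p (k + 1) (f • m) = 0 := by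
      induction hf using Submodule.span_induction with
      | mem f hf =>
        obtain ⟨v, rfl⟩ := hf
        simp [hp.X_smul, hk]
      | zero => simp
      | add f g _ _ hf hg => simp [add_smul, hf, hg]
      | smul a f _ hf => exact fun m => by rw [smul_assoc, smul_comm, hf]
    ext m
    have hm : m ∈ Ideal.span (Set.range (X : σ → MvPolynomial σ K)) •
        (⊤ : Submodule (MvPolynomial σ K) M) := by
      simp [htop]
    induction hm using Submodule.smul_induction_on' with
    | smul f hf m _ => exact hspan f hf m
    | add m₁ _ m₂ _ h₁ h₂ => rw [map_add, h₁, h₂, map_add]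
  induction k using Int.induction_on with
  | zero => simpa using hsucc (-1) (hneg _ (by norm_num))
  | succ k ih => exact hsucc k ih
  | pred k _ => exact hneg _ (by omega)

variable [IsScalarTower K (MvPolynomial σ K) M]

lemma of_surjective {N : Type*} [AddCommGroup N] [Module K N] [Module (MvPolynomial σ K) N]
    [IsScalarTower K (MvPolynomial σ K) N] (hp : IsProjectionFamily (σ := σ) K p)
    {π : M →ₗ[MvPolynomial σ K] N} (hπ : Function.Surjective π) {q : ℤ → N →ₗ[K] N}
    (hq : ∀ k, q k ∘ₗ π.restrictScalars K = π.restrictScalars K ∘ₗ p k) :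
    IsProjectionFamily (σ := σ) K q := by
  have hqπ (k : ℤ) (m : M) : q k (π m) = π (p k m) := LinearMap.congr_fun (hq k) m
  refine ⟨fun k => hπ.forall.2 fun m => ?_, fun v k => hπ.forall.2 fun m => ?_, fun k => ?_⟩
  · rw [hqπ, hqπ, hp.idem]
  · rw [← map_smul, hqπ, hqπ, hp.X_smul, map_smul]
  · have := hp.finite k
    rw [← LinearMap.range_comp_of_range_eq_top (q k) (f := π.restrictScalars K)
      (LinearMap.range_eq_top.2 hπ), hq, LinearMap.range_comp]
    infer_instance

variable [Fintype σ] {c : σ → K}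

lemma linearForm_smul (hp : IsProjectionFamily (σ := σ) K p) (c : σ → K) (k : ℤ) (m : M) :
    p (k + 1) (linearForm c • m) = linearForm c • p k m := by
  simp only [linearForm_apply, Finset.sum_smul, map_sum, smul_assoc, map_smul, hp.X_smul]

lemma exists_quotSMulTop (hp : IsProjectionFamily (σ := σ) K p) (c : σ → K) (k : ℤ) :
    ∃ q : QuotSMulTop (linearForm c) M →ₗ[K] QuotSMulTop (linearForm c) M,
      q ∘ₗ (Submodule.mkQ _).restrictScalars K = (Submodule.mkQ _).restrictScalars K ∘ₗ p k := by
  let P : Submodule (MvPolynomial σ K) M := linearForm c • ⊤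
  have hP : P.restrictScalars K ≤ (P.restrictScalars K).comap (p k) := by
    rintro _ ⟨m, -, rfl⟩
    refine ⟨p (k - 1) m, Submodule.mem_top, ?_⟩
    simpa using (hp.linearForm_smul c (k - 1) m).symm
  let e := Submodule.Quotient.restrictScalarsEquiv K P
  exact ⟨e ∘ₗ (P.restrictScalars K).mapQ (P.restrictScalars K) (p k) hP ∘ₗ e.symm,
    LinearMap.ext fun _ => rfl⟩

lemma finrank_range_quotSMulTop (hp : IsProjectionFamily (σ := σ) K p)
    (hc : IsSMulRegular M (linearForm c))
    {q : ℤ → QuotSMulTop (linearForm c) M →ₗ[K] QuotSMulTop (linearForm c) M}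
    (hq : ∀ k, q k ∘ₗ (Submodule.mkQ _).restrictScalars K =
      (Submodule.mkQ _).restrictScalars K ∘ₗ p k) (k : ℤ) :
    Module.finrank K (LinearMap.range (q k)) + Module.finrank K (LinearMap.range (p (k - 1))) =
      Module.finrank K (LinearMap.range (p k)) := by
  let π : M →ₗ[K] QuotSMulTop (linearForm c) M := (Submodule.mkQ _).restrictScalars K
  let μ : M →ₗ[K] M := (LinearMap.lsmul (MvPolynomial σ K) M (linearForm c)).restrictScalars K
  have hπ : LinearMap.range π = ⊤ :=
    LinearMap.range_eq_top.2 (linearForm c • ⊤ : Submodule (MvPolynomial σ K) M).mkQ_surjective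
  have hshift (m : M) : μ (p (k - 1) m) = p k (μ m) := by
    simpa [μ] using (hp.linearForm_smul c (k - 1) m).symm
  have hker : LinearMap.range (p k) ⊓ LinearMap.ker π = (LinearMap.range (p (k - 1))).map μ := by
    ext m
    constructor
    · rintro ⟨⟨m, rfl⟩, hm⟩
      obtain ⟨m', -, hm'⟩ := (Submodule.Quotient.mk_eq_zero _).1 hm
      change μ m' = p k m at hm'
      exact ⟨_, ⟨m', rfl⟩, by rw [hshift, hm', hp.idem]⟩
    · rintro ⟨_, ⟨m, rfl⟩, rfl⟩
      refine ⟨⟨μ m, (hshift m).symm⟩, (Submodule.Quotient.mk_eq_zero _).2 ?_⟩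
      exact ⟨p (k - 1) m, Submodule.mem_top, rfl⟩
  have := hp.finite k
  have hrank := (π.domRestrict (LinearMap.range (p k))).finrank_range_add_finrank_ker
  rwa [LinearMap.range_domRestrict, LinearMap.ker_domRestrict, ← LinearMap.range_comp, ← hq k,
    LinearMap.range_comp_of_range_eq_top _ hπ, ← Submodule.finrank_map_subtype_eq,
    Submodule.map_comap_subtype, hker, ← (Submodule.equivMapOfInjective μ hc _).finrank_eq] at hrank

lemma hasHilbertSeries_quotSMulTop (hp : IsProjectionFamily (σ := σ) K p) {φ : ℤ⟦X⟧}
    (hφ : HasHilbertSeries (fun k => LinearMap.range (p k)) φ)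
    (hc : IsSMulRegular M (linearForm c))
    {q : ℤ → QuotSMulTop (linearForm c) M →ₗ[K] QuotSMulTop (linearForm c) M}
    (hq : ∀ k, q k ∘ₗ (Submodule.mkQ _).restrictScalars K =
      (Submodule.mkQ _).restrictScalars K ∘ₗ p k) :
    HasHilbertSeries (fun k => LinearMap.range (q k)) ((1 - PowerSeries.X) * φ) where
  finrank_natCast k := by
    have hrank := hp.finrank_range_quotSMulTop hc hq k
    zify at hrank
    rw [hφ.finrank_natCast] at hrank
    rw [eq_sub_of_add_eq hrank, sub_mul, one_mul, map_sub]
    rcases k with - | k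
    · simp [hφ.finrank_of_neg]
    · rw [PowerSeries.coeff_succ_X_mul, ← hφ.finrank_natCast, ← hφ.finrank_natCast,
        Nat.cast_add_one, add_sub_cancel_right]
  finrank_of_neg k hk := by
    have hrank := hp.finrank_range_quotSMulTop hc hq k
    rw [hφ.finrank_of_neg k hk] at hrank
    omega

end IsProjectionFamily

open RingTheory.Sequence in
theorem IsProjectionFamily.negPow_mul_mem_nonnegSeries_of_infinite {K : Type u} [Field K]
    [Infinite K] {σ : Type} [Finite σ] {M : Type u} [AddCommGroup M] [Module K M]
    [Module (MvPolynomial σ K) M]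
    [IsScalarTower K (MvPolynomial σ K) M] [Module.Finite (MvPolynomial σ K) M]
    {p : ℤ → M →ₗ[K] M} (hp : IsProjectionFamily (σ := σ) K p) {φ : ℤ⟦X⟧}
    (hφ : HasHilbertSeries (fun k => LinearMap.range (p k)) φ)
    {rs : List (MvPolynomial σ K)}
    (hmem : ∀ f ∈ rs, f ∈ Ideal.span (Set.range (X : σ → MvPolynomial σ K)))
    (hreg : IsWeaklyRegular M rs) : negPow (-rs.length) * φ ∈ nonnegSeries := by
  cases nonempty_fintype σ
  induction hlen : rs.length generalizing M φ rs with
  | zero =>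
    intro k
    simp [← hφ.finrank_natCast]
  | succ d ih =>
    obtain ⟨x, rs, rfl⟩ := List.exists_cons_of_length_eq_add_one hlen
    by_cases htop : Ideal.span (Set.range (X : σ → MvPolynomial σ K)) •
      (⊤ : Submodule (MvPolynomial σ K) M) = ⊤
    · have hzero : φ = 0 := by
        ext k
        rw [← hφ.finrank_natCast, hp.eq_zero_of_smul_top_eq_top hφ htop, LinearMap.range_zero]
        simp
      simp [hzero]
    · have hreg' : IsRegular M (x :: rs) := ⟨hreg, fun h => htop (top_le_iff.1 (h.le.trans ?_))⟩
      · obtain ⟨c, hc⟩ := exists_isSMulRegular_linearForm (hmem x List.mem_cons_self)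
          ((isWeaklyRegular_cons_iff M x rs).1 hreg).1
        obtain ⟨rs', hlen', hmem', hrs'⟩ :=
          exists_isRegular_quotSMulTop htop (linearForm_mem c) hc hmem hreg'
        choose q hq using hp.exists_quotSMulTop c
        have hqp := hp.of_surjective (Submodule.mkQ_surjective _) hq
        have hqφ := hp.hasHilbertSeries_quotSMulTop hφ hc hq
        have := ih hqp hqφ hmem' hrs'.toIsWeaklyRegular (hlen'.trans (by simpa using hlen))
        rwa [← mul_assoc, ← pow_one (1 - PowerSeries.X), ← negPow_neg_natCast, ← negPow_add,
          ← neg_add, ← Nat.cast_add] at this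
      · exact Submodule.smul_mono_left (Ideal.span_le.2 hmem)

end ProjectionFamilies

section BaseChange

attribute [local instance] MvPolynomial.algebraMvPolynomial

open TensorProduct RingTheory.Sequence

lemma nonempty_baseChange_range_equiv {K : Type*} (L : Type*) [Field K] [Field L] [Algebra K L]
    {M : Type*} [AddCommGroup M] [Module K M] (f : M →ₗ[K] M) :
    Nonempty (L ⊗[K] LinearMap.range f ≃ₗ[L] LinearMap.range (f.baseChange L)) := by
  have hinj : Function.Injective ((LinearMap.range f).subtype.baseChange L) :=
    Module.Flat.lTensor_preserves_injective_linearMap _ (Submodule.injective_subtype _)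
  have hsurj : Function.Surjective (f.rangeRestrict.baseChange L) :=
    LinearMap.lTensor_surjective L f.surjective_rangeRestrict
  have hrange : LinearMap.range ((LinearMap.range f).subtype.baseChange L) =
      LinearMap.range (f.baseChange L) := by
    rw [← LinearMap.range_comp_of_range_eq_top _ (LinearMap.range_eq_top.2 hsurj),
      ← LinearMap.baseChange_comp]
    rfl
  exact ⟨LinearEquiv.ofInjective _ hinj ≪≫ₗ LinearEquiv.ofEq _ _ hrange⟩

variable {K L : Type*} [Field K] [Field L] [Algebra K L] {σ : Type}

lemma X_smul_C_tmul {M : Type*} [AddCommGroup M] [Module (MvPolynomial σ K) M]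
    (v : σ) (l : L) (m : M) :
    (X v : MvPolynomial σ L) • ((C l : MvPolynomial σ L) ⊗ₜ[MvPolynomial σ K] m) =
      (C l : MvPolynomial σ L) ⊗ₜ ((X v : MvPolynomial σ K) • m) := by
  rw [TensorProduct.smul_tmul', TensorProduct.tmul_smul, TensorProduct.smul_tmul', smul_eq_mul,
    Algebra.smul_def, MvPolynomial.algebraMap_def, map_X]

variable (L) {M : Type*} [AddCommGroup M] [Module K M] [Module (MvPolynomial σ K) M]
  [IsScalarTower K (MvPolynomial σ K) M]

/-- The endomorphism of `L[X] ⊗ M`, for `M` a `K[X]`-module, that corresponds to the base change of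
`f` under `L[X] ⊗ M ≃ L ⊗ M`. -/
noncomputable def polynomialBaseChange (f : M →ₗ[K] M) :
    MvPolynomial σ L ⊗[MvPolynomial σ K] M →ₗ[L] MvPolynomial σ L ⊗[MvPolynomial σ K] M :=
  (Algebra.IsPushout.cancelBaseChange K L (MvPolynomial σ K) (MvPolynomial σ L) M).symm.conj
    (f.baseChange L)

variable {L}

lemma polynomialBaseChange_tmul (f : M →ₗ[K] M) (l : L) (m : M) :
    polynomialBaseChange L f ((C l : MvPolynomial σ L) ⊗ₜ[MvPolynomial σ K] m) =
      (C l : MvPolynomial σ L) ⊗ₜ f m := by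
  let e := Algebra.IsPushout.cancelBaseChange K L (MvPolynomial σ K) (MvPolynomial σ L) M
  have he (m : M) : e.symm (l ⊗ₜ m) = (C l : MvPolynomial σ L) ⊗ₜ[MvPolynomial σ K] m :=
    Algebra.IsPushout.cancelBaseChange_symm_tmul K L _ _ M l m
  calc polynomialBaseChange L f (C l ⊗ₜ m)
      = e.symm (f.baseChange L (e (e.symm (l ⊗ₜ m)))) := by rw [he]; rfl
    _ = C l ⊗ₜ f m := by rw [e.apply_symm_apply, LinearMap.baseChange_tmul, he]

lemma polynomialBaseChange_induction
    {P : MvPolynomial σ L ⊗[MvPolynomial σ K] M → Prop} (zero : P 0)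
    (tmul : ∀ (l : L) m, P ((C l : MvPolynomial σ L) ⊗ₜ m))
    (add : ∀ x y, P x → P y → P (x + y)) (z) : P z := by
  let e := Algebra.IsPushout.cancelBaseChange K L (MvPolynomial σ K) (MvPolynomial σ L) M
  obtain ⟨z, rfl⟩ := e.symm.surjective z
  induction z using TensorProduct.induction_on with
  | zero => rwa [map_zero]
  | tmul l m =>
    rw [Algebra.IsPushout.cancelBaseChange_symm_tmul]
    exact tmul l m
  | add x y hx hy =>
    rw [map_add]
    exact add _ _ hx hy

lemma nonempty_range_polynomialBaseChange_equiv (f : M →ₗ[K] M) :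
    Nonempty (L ⊗[K] LinearMap.range f ≃ₗ[L]
      LinearMap.range (polynomialBaseChange (σ := σ) L f)) := by
  obtain ⟨e⟩ := nonempty_baseChange_range_equiv L f
  have hrange : LinearMap.range (polynomialBaseChange (σ := σ) L f) = (LinearMap.range
      (f.baseChange L)).map (Algebra.IsPushout.cancelBaseChange K L (MvPolynomial σ K)
        (MvPolynomial σ L) M).symm.toLinearMap := by
    rw [polynomialBaseChange, LinearEquiv.conj_apply, LinearEquiv.symm_symm,
      LinearEquiv.range_comp, LinearMap.range_comp]
  rw [hrange]
  exact ⟨e.trans (LinearEquiv.submoduleMap _ _)⟩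

variable (L) {p : ℤ → M →ₗ[K] M}

lemma IsProjectionFamily.baseChange (hp : IsProjectionFamily (σ := σ) K p) :
    IsProjectionFamily (σ := σ) L fun k => polynomialBaseChange (σ := σ) L (p k) where
  idem k z := by
    induction z using polynomialBaseChange_induction with
    | zero => simp only [map_zero]
    | tmul l m => simp only [polynomialBaseChange_tmul, hp.idem]
    | add x y hx hy => simp only [map_add, hx, hy]
  X_smul v k z := by
    induction z using polynomialBaseChange_induction with
    | zero => simp only [map_zero, smul_zero]
    | tmul l m => simp only [X_smul_C_tmul, polynomialBaseChange_tmul, hp.X_smul]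
    | add x y hx hy => simp only [smul_add, map_add, hx, hy]
  finite k := by
    have := hp.finite k
    exact Module.Finite.equiv (nonempty_range_polynomialBaseChange_equiv (p k)).some

lemma HasHilbertSeries.baseChange {φ : ℤ⟦X⟧}
    (hφ : HasHilbertSeries (fun k => LinearMap.range (p k)) φ) :
    HasHilbertSeries (fun k => LinearMap.range (polynomialBaseChange (σ := σ) L (p k))) φ := by
  have hrank (k : ℤ) : Module.finrank L (LinearMap.range (polynomialBaseChange (σ := σ) L (p k))) =
      Module.finrank K (LinearMap.range (p k)) := by
    rw [← (nonempty_range_polynomialBaseChange_equiv (p k)).some.finrank_eq,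
      Module.finrank_baseChange]
  exact ⟨fun k => hrank k ▸ hφ.finrank_natCast k, fun k hk => hrank k ▸ hφ.finrank_of_neg k hk⟩

lemma algebraMap_mem_span_range_X {f : MvPolynomial σ K}
    (hf : f ∈ Ideal.span (Set.range (X : σ → MvPolynomial σ K))) :
    algebraMap (MvPolynomial σ K) (MvPolynomial σ L) f ∈
      Ideal.span (Set.range (X : σ → MvPolynomial σ L)) := by
  have h := Ideal.mem_map_of_mem (algebraMap (MvPolynomial σ K) (MvPolynomial σ L)) hf
  rw [Ideal.map_span, ← Set.range_comp] at h
  convert h using 4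
  ext1 v
  simp

variable {L}

theorem IsProjectionFamily.negPow_mul_mem_nonnegSeries {K : Type u} [Field K] {σ : Type}
    [Finite σ] {M : Type u} [AddCommGroup M] [Module K M] [Module (MvPolynomial σ K) M]
    [IsScalarTower K (MvPolynomial σ K) M] [Module.Finite (MvPolynomial σ K) M]
    {p : ℤ → M →ₗ[K] M} (hp : IsProjectionFamily (σ := σ) K p) {φ : ℤ⟦X⟧}
    (hφ : HasHilbertSeries (fun k => LinearMap.range (p k)) φ) {rs : List (MvPolynomial σ K)}
    (hmem : ∀ f ∈ rs, f ∈ Ideal.span (Set.range (X : σ → MvPolynomial σ K)))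
    (hreg : IsWeaklyRegular M rs) : negPow (-rs.length) * φ ∈ nonnegSeries := by
  cases nonempty_fintype σ
  let S := MvPolynomial σ K
  let L := AlgebraicClosure K
  let S' := MvPolynomial σ L
  have : Infinite L := IsAlgClosed.instInfinite
  have : Module.Flat S S' := Module.Flat.isBaseChange K S L S' Algebra.IsPushout.out
  have hreg' : IsWeaklyRegular (S' ⊗[S] M) (rs.map (algebraMap S S')) :=
    hreg.of_flat_of_isBaseChange (TensorProduct.isBaseChange S M S')
  have hmem' : ∀ f ∈ rs.map (algebraMap S S'), f ∈ Ideal.span (Set.range (X : σ → S')) :=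
    List.forall_mem_map.2 fun f hf => algebraMap_mem_span_range_X L (hmem f hf)
  simpa using (hp.baseChange L).negPow_mul_mem_nonnegSeries_of_infinite (hφ.baseChange L)
    hmem' hreg'

end BaseChange

section Gradings

variable {K : Type u} [Field K] {σ : Type} {M : Type u} [AddCommGroup M] [Module K M]
  [Module (MvPolynomial σ K) M] {ℳ : ℤ → Submodule K M} (h : IsGrading (σ := σ) ℳ)

namespace IsGrading

/-- The projection of a graded module onto its homogeneous component of degree `k`, as an
endomorphism of the whole module. -/
noncomputable def proj (k : ℤ) : M →ₗ[K] M :=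
  letI := h.isInternal.chooseDecomposition
  (ℳ k).subtype ∘ₗ DirectSum.component K ℤ (fun k => ℳ k) k ∘ₗ
    (DirectSum.decomposeLinearEquiv ℳ).toLinearMap

lemma proj_mem (k : ℤ) (m : M) : h.proj k m ∈ ℳ k :=
  Subtype.property _

lemma proj_of_mem {k : ℤ} {m : M} (hm : m ∈ ℳ k) : h.proj k m = m :=
  letI := h.isInternal.chooseDecomposition
  DirectSum.decompose_of_mem_same ℳ hm

lemma proj_of_mem_ne {j k : ℤ} {m : M} (hm : m ∈ ℳ j) (hjk : j ≠ k) : h.proj k m = 0 :=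
  letI := h.isInternal.chooseDecomposition
  DirectSum.decompose_of_mem_ne ℳ hm hjk

lemma range_proj (k : ℤ) : LinearMap.range (h.proj k) = ℳ k := by
  refine le_antisymm ?_ fun m hm => ⟨m, h.proj_of_mem hm⟩
  rintro _ ⟨m, rfl⟩
  exact h.proj_mem k m

include h in
lemma induction {P : M → Prop} (zero : P 0) (homogeneous : ∀ j, ∀ m ∈ ℳ j, P m)
    (add : ∀ m m', P m → P m' → P (m + m')) (m : M) : P m :=
  letI := h.isInternal.chooseDecomposition
  DirectSum.Decomposition.inductionOn ℳ zero (fun {j} x => homogeneous j x x.2) add m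

lemma proj_smul {i : ℤ} {f : MvPolynomial σ K} (hf : f ∈ stdGrading K σ i) (k : ℤ) (m : M) :
    h.proj (i + k) (f • m) = f • h.proj k m := by
  induction m using h.induction with
  | zero => simp
  | homogeneous j m hm =>
    have hfm : f • m ∈ ℳ (i + j) := h.smul_mem _ _ _ _ hf hm
    rcases eq_or_ne j k with rfl | hjk
    · rw [h.proj_of_mem hfm, h.proj_of_mem hm]
    · rw [h.proj_of_mem_ne hfm (by omega), h.proj_of_mem_ne hm hjk, smul_zero]
  | add m m' hm hm' => rw [smul_add, map_add, map_add, smul_add, hm, hm']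

include h in
lemma span_iUnion_eq_top :
    Submodule.span (MvPolynomial σ K) (⋃ j, (ℳ j : Set M)) = ⊤ := by
  refine eq_top_iff.2 fun m _ => ?_
  induction m using h.induction with
  | zero => exact zero_mem _
  | homogeneous j m hm => exact Submodule.subset_span (Set.mem_iUnion_of_mem j hm)
  | add m m' hm hm' => exact add_mem (hm trivial) (hm' trivial)

variable [IsScalarTower K (MvPolynomial σ K) M]

lemma proj_smul_mem {j k : ℤ} {m : M} (hm : m ∈ ℳ j) (f : MvPolynomial σ K) :
    h.proj k (f • m) ∈ (stdGrading K σ (k - j)).map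
      ((LinearMap.toSpanSingleton (MvPolynomial σ K) M m).restrictScalars K) := by
  induction f using MvPolynomial.induction_on' with
  | monomial s a =>
    have hs : monomial s a ∈ stdGrading K σ s.degree := by
      refine mem_stdGrading.2 fun m hm => ?_
      rw [Finset.mem_singleton.1 (support_monomial_subset hm)]
    have hsm : monomial s a • m ∈ ℳ (s.degree + j) := h.smul_mem _ _ _ _ hs hm
    rcases eq_or_ne ((s.degree : ℤ) + j) k with rfl | hk
    · rw [h.proj_of_mem hsm, add_sub_cancel_right]
      exact ⟨monomial s a, hs, rfl⟩
    · rw [h.proj_of_mem_ne hsm hk]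
      exact zero_mem _
  | add p q hp hq =>
    rw [add_smul, map_add]
    exact add_mem hp hq

include h in
lemma finite [Finite σ] [Module.Finite (MvPolynomial σ K) M] (k : ℤ) :
    Module.Finite K (ℳ k) := by
  obtain ⟨G, hG, hspan⟩ := (Submodule.fg_span_iff_fg_span_finset_subset _).1
    (h.span_iUnion_eq_top ▸ Module.Finite.fg_top)
  choose deg hdeg using fun g : G => Set.mem_iUnion.1 (hG g.2)
  have hle : ℳ k ≤ ⨆ g : G, (stdGrading K σ (k - deg g)).map
      ((LinearMap.toSpanSingleton (MvPolynomial σ K) M g).restrictScalars K) := by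
    intro m hm
    have hmG : m ∈ Submodule.span (MvPolynomial σ K) (G : Set M) := by
      rw [← hspan, h.span_iUnion_eq_top]
      trivial
    obtain ⟨f, rfl⟩ := Submodule.mem_span_finset'.1 hmG
    rw [← h.proj_of_mem hm, map_sum]
    exact sum_mem fun g _ => Submodule.mem_iSup_of_mem g (h.proj_smul_mem (hdeg g) (f g))
  exact Submodule.finiteDimensional_of_le hle

include h in
lemma isProjectionFamily_proj [Finite σ] [Module.Finite (MvPolynomial σ K) M] :
    IsProjectionFamily (σ := σ) K h.proj where
  idem k m := h.proj_of_mem (h.proj_mem k m)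
  X_smul v k m := by
    rw [add_comm]
    exact h.proj_smul (isWeightedHomogeneous_X K _ v) k m
  finite k := by
    rw [h.range_proj]
    exact h.finite k

include h in
theorem negPow_mul_mem_nonnegSeries [Finite σ] [Module.Finite (MvPolynomial σ K) M] {φ : ℤ⟦X⟧}
    (hφ : HasHilbertSeries ℳ φ) {rs : List (MvPolynomial σ K)}
    (hmem : ∀ f ∈ rs, f ∈ Ideal.span (Set.range (X : σ → MvPolynomial σ K)))
    (hreg : RingTheory.Sequence.IsWeaklyRegular M rs) :
    negPow (-rs.length) * φ ∈ nonnegSeries := by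
  refine h.isProjectionFamily_proj.negPow_mul_mem_nonnegSeries ?_ hmem hreg
  simpa only [h.range_proj] using hφ

end IsGrading

end Gradings

section RegularProducts

open RingTheory.Sequence

lemma smul_top_prod {R : Type*} [CommRing R] (M N : Type*) [AddCommGroup M] [Module R M]
    [AddCommGroup N] [Module R N] (I : Ideal R) :
    I • (⊤ : Submodule R (M × N)) = (I • ⊤ : Submodule R M).prod (I • ⊤) := by
  rw [← Submodule.prod_top, LinearMap.prod_eq_sup_map, Submodule.smul_sup, ← Submodule.map_smul'',
    ← Submodule.map_smul'', ← LinearMap.prod_eq_sup_map]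

lemma isWeaklyRegular_prod {R M N : Type*} [CommRing R] [AddCommGroup M] [Module R M]
    [AddCommGroup N] [Module R N] {rs : List R} (hM : IsWeaklyRegular M rs)
    (hN : IsWeaklyRegular N rs) : IsWeaklyRegular (M × N) rs := by
  refine ⟨fun i hi => (isSMulRegular_quotient_iff_mem_of_smul_mem _ _).2 fun x hx => ?_⟩
  rw [smul_top_prod] at hx ⊢
  exact ⟨mem_of_isSMulRegular_quotient_of_smul_mem (hM.regular_mod_prev i hi) hx.1,
    mem_of_isSMulRegular_quotient_of_smul_mem (hN.regular_mod_prev i hi) hx.2⟩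

lemma isRegular_prod {R M N : Type*} [CommRing R] [AddCommGroup M] [Module R M]
    [AddCommGroup N] [Module R N] {rs : List R} (hM : IsRegular M rs)
    (hN : IsWeaklyRegular N rs) : IsRegular (M × N) rs := by
  refine ⟨isWeaklyRegular_prod hM.toIsWeaklyRegular hN, fun h => hM.top_ne_smul ?_⟩
  have hfst := congrArg (Submodule.map (LinearMap.fst R M N)) h
  rwa [smul_top_prod, Submodule.prod_map_fst, ← Submodule.prod_top, Submodule.prod_map_fst] at hfst

variable {K τ : Type*} [Field K]

lemma isSMulRegular_X_quotient_span_X_image {s : Set τ} {v : τ} (hv : v ∉ s) :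
    IsSMulRegular (MvPolynomial τ K ⧸ Ideal.span (X '' s : Set (MvPolynomial τ K)))
      (X v : MvPolynomial τ K) := by
  refine (isSMulRegular_quotient_iff_mem_of_smul_mem _ _).2 fun f hf => ?_
  rw [mem_ideal_span_X_image] at hf ⊢
  intro m hm
  obtain ⟨w, hw, hmw⟩ := hf (Finsupp.single v 1 + m) (by
    rw [smul_eq_mul, mem_support_iff, coeff_X_mul]
    exact mem_support_iff.1 hm)
  have hvw : v ≠ w := by
    rintro rfl
    exact hv hw
  exact ⟨w, hw, by simpa [Finsupp.single_apply, hvw] using hmw⟩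

lemma isRegular_map_X {l : List τ} (hl : l.Nodup) :
    IsRegular (MvPolynomial τ K) (l.map X : List (MvPolynomial τ K)) := by
  have hspan (l : List τ) : Ideal.ofList (l.map X : List (MvPolynomial τ K)) =
      Ideal.span (X '' {v | v ∈ l}) := by
    simp [Ideal.ofList, Set.image]
  refine ⟨⟨fun i hi => ?_⟩, fun h => ?_⟩
  · rw [← List.map_take, smul_eq_mul, Ideal.mul_top, hspan, List.getElem_map]
    refine isSMulRegular_X_quotient_span_X_image fun hmem => ?_
    obtain ⟨j, hj, hji⟩ := List.mem_take_iff_getElem.1 hmem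
    have := (List.Nodup.getElem_inj_iff hl).1 hji
    omega
  · rw [smul_eq_mul, Ideal.mul_top, hspan] at h
    have hone : (1 : MvPolynomial τ K) ∈ Ideal.span (X '' {v | v ∈ l}) := by
      simp [← h]
    obtain ⟨v, -, hv⟩ := mem_ideal_span_X_image.1 hone 0 (by simp)
    exact hv rfl

end RegularProducts

section InternalSums

variable {R M N ι : Type*} [Ring R] [AddCommGroup M] [Module R M] [AddCommGroup N] [Module R N]
  [DecidableEq ι] {A : ι → Submodule R M}

lemma isInternal_prod {B : ι → Submodule R N} (hA : DirectSum.IsInternal A)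
    (hB : DirectSum.IsInternal B) : DirectSum.IsInternal fun i => (A i).prod (B i) := by
  rw [DirectSum.isInternal_submodule_iff_iSupIndep_and_iSup_eq_top] at *
  refine ⟨fun i => ?_, ?_⟩
  · have hle : ⨆ j, ⨆ (_ : j ≠ i), (A j).prod (B j) ≤
        (⨆ j, ⨆ (_ : j ≠ i), A j).prod (⨆ j, ⨆ (_ : j ≠ i), B j) :=
      iSup₂_le fun j hj => Submodule.prod_mono (le_iSup₂_of_le j hj le_rfl)
        (le_iSup₂_of_le j hj le_rfl)
    refine Disjoint.mono_right hle ?_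
    rw [disjoint_iff, Submodule.prod_inf_prod, (hA.1 i).eq_bot, (hB.1 i).eq_bot,
      Submodule.prod_bot]
  · simp only [LinearMap.prod_eq_sup_map, iSup_sup_eq, ← Submodule.map_iSup]
    rw [hA.2, hB.2, ← LinearMap.prod_eq_sup_map, Submodule.prod_top]

lemma isInternal_comp_equiv {κ : Type*} [DecidableEq κ] (hA : DirectSum.IsInternal A)
    (e : κ ≃ ι) : DirectSum.IsInternal fun k => A (e k) := by
  rw [DirectSum.isInternal_submodule_iff_iSupIndep_and_iSup_eq_top] at *
  exact ⟨hA.1.comp e.injective, by rw [e.iSup_comp, hA.2]⟩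

end InternalSums

section Realization

variable {K : Type u} [Field K] {σ : Type}

lemma isInternal_stdGrading : DirectSum.IsInternal (stdGrading K σ) :=
  letI := weightedDecomposition K fun _ : σ => (1 : ℤ)
  DirectSum.Decomposition.isInternal _

lemma IsGrading.prod {M N : Type u} [AddCommGroup M] [Module K M] [Module (MvPolynomial σ K) M]
    [AddCommGroup N] [Module K N] [Module (MvPolynomial σ K) N] {ℳ : ℤ → Submodule K M}
    {𝒩 : ℤ → Submodule K N} (hM : IsGrading (σ := σ) ℳ) (hN : IsGrading (σ := σ) 𝒩) :
    IsGrading (σ := σ) fun k => (ℳ k).prod (𝒩 k) where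
  isInternal := isInternal_prod hM.isInternal hN.isInternal
  smul_mem i j f _ hf hm := ⟨hM.smul_mem i j f _ hf hm.1, hN.smul_mem i j f _ hf hm.2⟩

namespace HasHilbertSeries

variable {M N : Type*} [AddCommGroup M] [Module K M] [AddCommGroup N] [Module K N]
  {ℳ : ℤ → Submodule K M} {𝒩 : ℤ → Submodule K N} {φ ψ : ℤ⟦X⟧}

lemma finrank_eq (hM : HasHilbertSeries ℳ φ) (hN : HasHilbertSeries 𝒩 φ) (k : ℤ) :
    Module.finrank K (ℳ k) = Module.finrank K (𝒩 k) := by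
  rcases lt_or_ge k 0 with hk | hk
  · rw [hM.finrank_of_neg k hk, hN.finrank_of_neg k hk]
  · lift k to ℕ using hk
    exact_mod_cast (hM.finrank_natCast k).trans (hN.finrank_natCast k).symm

lemma congr (hM : HasHilbertSeries ℳ φ)
    (h : ∀ k, Module.finrank K (𝒩 k) = Module.finrank K (ℳ k)) : HasHilbertSeries 𝒩 φ where
  finrank_natCast k := by rw [h, hM.finrank_natCast]
  finrank_of_neg k hk := by rw [h, hM.finrank_of_neg k hk]

lemma shift (hM : HasHilbertSeries ℳ φ) (s : ℕ) :
    HasHilbertSeries (fun k => ℳ (k - s)) (PowerSeries.X ^ s * φ) where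
  finrank_natCast k := by
    rw [PowerSeries.coeff_X_pow_mul']
    split_ifs with hsk
    · rw [← Nat.cast_sub hsk, hM.finrank_natCast]
    · rw [hM.finrank_of_neg _ (by omega), Nat.cast_zero]
  finrank_of_neg k hk := hM.finrank_of_neg _ (by omega)

lemma prod (hM : HasHilbertSeries ℳ φ) (hN : HasHilbertSeries 𝒩 ψ)
    (hMfin : ∀ k, Module.Finite K (ℳ k)) (hNfin : ∀ k, Module.Finite K (𝒩 k)) :
    HasHilbertSeries (fun k => (ℳ k).prod (𝒩 k)) (φ + ψ) := by
  have hfinrank (k : ℤ) : Module.finrank K ((ℳ k).prod (𝒩 k)) =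
      Module.finrank K (ℳ k) + Module.finrank K (𝒩 k) := by
    rw [← Module.finrank_prod, ← LinearMap.finrank_range_of_inj
      (f := (ℳ k).subtype.prodMap (𝒩 k).subtype)
      ((ℳ k).subtype_injective.prodMap (𝒩 k).subtype_injective),
      LinearMap.range_prodMap, Submodule.range_subtype, Submodule.range_subtype]
  constructor
  · intro k
    rw [hfinrank, map_add, ← hM.finrank_natCast, ← hN.finrank_natCast, Nat.cast_add]
  · intro k hk
    rw [hfinrank, hM.finrank_of_neg k hk, hN.finrank_of_neg k hk]

end HasHilbertSeries

/-- The series `φ` is the Hilbert series of a finitely generated graded module on which `rs` is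
regular. -/
def IsRealizable (rs : List (MvPolynomial σ K)) (φ : ℤ⟦X⟧) : Prop :=
  ∃ (N : Type u) (_ : AddCommGroup N) (_ : Module K N) (_ : Module (MvPolynomial σ K) N)
    (_ : IsScalarTower K (MvPolynomial σ K) N) (𝒩 : ℤ → Submodule K N),
    Module.Finite (MvPolynomial σ K) N ∧ IsGrading (σ := σ) 𝒩 ∧ HasHilbertSeries 𝒩 φ ∧
      RingTheory.Sequence.IsRegular N rs

lemma IsRealizable.add [Finite σ] {rs : List (MvPolynomial σ K)} {φ ψ : ℤ⟦X⟧}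
    (hφ : IsRealizable rs φ) (hψ : IsRealizable rs ψ) : IsRealizable rs (φ + ψ) := by
  obtain ⟨M, _, _, _, _, ℳ, _, hM, hMφ, hMreg⟩ := hφ
  obtain ⟨N, _, _, _, _, 𝒩, _, hN, hNψ, hNreg⟩ := hψ
  exact ⟨M × N, inferInstance, inferInstance, inferInstance, inferInstance,
    fun k => (ℳ k).prod (𝒩 k), inferInstance, hM.prod hN, hMφ.prod hNψ hM.finite hN.finite,
    isRegular_prod hMreg hNreg.toIsWeaklyRegular⟩

lemma killCompl_mem_stdGrading {τ : Type} {g : τ → σ} (hg : Function.Injective g) {k : ℤ}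
    {f : MvPolynomial σ K} (hf : f ∈ stdGrading K σ k) : killCompl hg f ∈ stdGrading K τ k := by
  refine mem_stdGrading.2 fun m hm => ?_
  rw [mem_support_iff, coeff_killCompl] at hm
  rw [← Finsupp.degree_mapDomain g m, mem_stdGrading.1 hf _ (mem_support_iff.2 hm)]

lemma isRealizable_X_pow_mul_negPow {τ : Type} [Fintype τ] {g : τ → σ}
    (hg : Function.Injective g) {l : List τ} (hl : l.Nodup) (s : ℕ) :
    IsRealizable ((l.map g).map X : List (MvPolynomial σ K))
      (PowerSeries.X ^ s * negPow (Fintype.card τ)) := by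
  let π : MvPolynomial σ K →ₐ[K] MvPolynomial τ K := killCompl hg
  let : Algebra (MvPolynomial σ K) (MvPolynomial τ K) := π.toRingHom.toAlgebra
  have htower : IsScalarTower K (MvPolynomial σ K) (MvPolynomial τ K) :=
    IsScalarTower.of_algebraMap_eq fun c => (π.commutes c).symm
  have hfinite : Module.Finite (MvPolynomial σ K) (MvPolynomial τ K) :=
    Module.Finite.of_surjective (Algebra.linearMap (MvPolynomial σ K) (MvPolynomial τ K))
      fun f => ⟨rename g f, killCompl_rename_app hg f⟩
  have hgrading : IsGrading (σ := σ) fun k => stdGrading K τ (k - s) := by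
    refine ⟨isInternal_comp_equiv isInternal_stdGrading (Equiv.subRight (s : ℤ)), ?_⟩
    intro i j f m hf hm
    rw [add_sub_assoc]
    exact IsWeightedHomogeneous.mul (killCompl_mem_stdGrading hg hf) hm
  have hregular : RingTheory.Sequence.IsRegular (MvPolynomial τ K)
      ((l.map g).map X : List (MvPolynomial σ K)) := by
    refine ((AddEquiv.refl _).isRegular_congr ?_).1 (isRegular_map_X hl)
    rw [List.map_map, List.forall₂_map_left_iff, List.forall₂_map_right_iff, List.forall₂_same]
    intro v _ f
    change X v * f = π (X (g v)) * f
    rw [← rename_X g v, killCompl_rename_app]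
  exact ⟨_, inferInstance, inferInstance, inferInstance, htower, _, hfinite, hgrading,
    hasHilbertSeries_stdGrading.shift s, hregular⟩

lemma isRealizable_of_mem_decomposable [Fintype σ] {l : List σ} (hl : l.Nodup) {φ : ℤ⟦X⟧}
    (hφ : φ ≠ 0) (h : negPow (-l.length) * φ ∈ decomposable (Fintype.card σ - l.length)) :
    IsRealizable (l.map X : List (MvPolynomial σ K)) φ := by
  classical
  have hcard : l.toFinset.card = l.length := List.toFinset_card_of_nodup hl
  have hzero_or : ∀ ψ ∈ decomposable (Fintype.card σ - l.length), negPow l.length * ψ = 0 ∨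
      IsRealizable (l.map X : List (MvPolynomial σ K)) (negPow l.length * ψ) := by
    intro ψ hψ
    induction hψ using AddSubmonoid.closure_induction with
    | mem x hx =>
      obtain ⟨s, j, hj, rfl⟩ := hx
      obtain ⟨T, hlT, hT⟩ := Finset.exists_superset_card_eq (s := l.toFinset)
        (n := l.length + j) (by omega) (by have := l.toFinset.card_le_univ; omega)
      lift l to List T using fun v hv => hlT (List.mem_toFinset.2 hv)
      have hT' : (Fintype.card T : ℤ) = l.length + j := by simp [hT]
      rw [mul_left_comm, ← negPow_add, List.length_map, ← hT']
      exact .inr (isRealizable_X_pow_mul_negPow Subtype.val_injective hl.of_map s)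
    | zero => exact .inl (mul_zero _)
    | add x y _ _ hx hy =>
      rw [mul_add]
      rcases hx, hy with ⟨hx | hx, hy | hy⟩
      · simp [hx, hy]
      · exact .inr (by rwa [hx, zero_add])
      · exact .inr (by rwa [hy, add_zero])
      · exact .inr (hx.add hy)
  have hφ_eq : negPow l.length * (negPow (-l.length) * φ) = φ := by
    rw [← mul_assoc, ← negPow_add, add_neg_cancel, negPow_zero, one_mul]
  simpa only [hφ_eq, hφ, false_or] using hzero_or _ h

end Realization

section Depth

variable {K : Type u} [Field K] {σ : Type} {M : Type u} [AddCommGroup M] [Module K M]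
  {ℳ : ℤ → Submodule K M} {φ : ℤ⟦X⟧}

lemma decomposable_le_nonnegSeries (m : ℕ) : decomposable m ≤ nonnegSeries.toAddSubmonoid := by
  refine AddSubmonoid.closure_le.2 ?_
  rintro _ ⟨s, j, -, rfl⟩ k
  rw [PowerSeries.coeff_X_pow_mul']
  split_ifs
  · exact negPow_natCast_mem j _
  · exact le_rfl

lemma HasHilbertSeries.hdepth_le [Finite σ] (hℳ : HasHilbertSeries ℳ φ) {h : ℕ}
    (hle : ∀ d : ℕ, negPow (-d) * φ ∈ nonnegSeries → d ≤ h) : hdepth σ ℳ ≤ h := by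
  refine sSup_le ?_
  rintro _ ⟨N, _, _, _, _, 𝒩, _, hN, hfinrank, rfl⟩
  refine iSup₂_le fun rs ⟨hmem, hreg⟩ => ?_
  exact_mod_cast hle rs.length
    (hN.negPow_mul_mem_nonnegSeries (hℳ.congr hfinrank) hmem hreg.toIsWeaklyRegular)

lemma HasHilbertSeries.le_hdepth [Fintype σ] (hℳ : HasHilbertSeries ℳ φ) (hφ : φ ≠ 0) {h : ℕ}
    (hcard : h ≤ Fintype.card σ)
    (hdec : negPow (-h) * φ ∈ decomposable (Fintype.card σ - h)) : h ≤ hdepth σ ℳ := by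
  obtain ⟨T, -, rfl⟩ := Finset.exists_subset_card_eq (s := (Finset.univ : Finset σ)) hcard
  rw [← T.length_toList] at hdec ⊢
  obtain ⟨N, i₁, i₂, i₃, i₄, 𝒩, hfinite, hN, hNφ, hreg⟩ :=
    isRealizable_of_mem_decomposable (K := K) T.nodup_toList hφ hdec
  refine le_trans ?_ (le_sSup ⟨N, i₁, i₂, i₃, i₄, 𝒩, hfinite, hN, hNφ.finrank_eq hℳ, rfl⟩)
  refine le_trans ?_ (le_iSup₂ (T.toList.map X) ⟨fun f hf => ?_, hreg⟩)
  · rw [List.length_map]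
  · obtain ⟨v, -, rfl⟩ := List.mem_map.1 hf
    exact Ideal.subset_span ⟨v, rfl⟩

theorem HasHilbertSeries.exists_hdepth_eq_isGreatest [Fintype σ] (hℳ : HasHilbertSeries ℳ φ)
    {lower upper : ℕ} (hcard : upper ≤ Fintype.card σ)
    (hlower : negPow (-lower) * φ ∈ nonnegSeries)
    (hupper : ∀ d : ℕ, negPow (-d) * φ ∈ nonnegSeries → d ≤ upper) {P : ℕ → Prop}
    (hP : ∀ d : ℕ, negPow (-d) * φ ∈ nonnegSeries → P d)
    (hdec : ∀ d ≤ upper, P d → negPow (-d) * φ ∈ decomposable (Fintype.card σ - d)) :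
    ∃ h : ℕ, hdepth σ ℳ = h ∧ IsGreatest {d | lower ≤ d ∧ d ≤ upper ∧ P d} h := by
  classical
  have hφ : φ ≠ 0 := by
    rintro rfl
    have := hupper (upper + 1) (by simp)
    omega
  set h := Nat.findGreatest (fun d => negPow (-d) * φ ∈ nonnegSeries) upper
  have hh : negPow (-h) * φ ∈ nonnegSeries :=
    Nat.findGreatest_spec (P := fun d : ℕ => negPow (-d) * φ ∈ nonnegSeries)
      (hupper _ hlower) hlower
  have hmax (d : ℕ) (hd : negPow (-d) * φ ∈ nonnegSeries) : d ≤ h :=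
    Nat.le_findGreatest (hupper d hd) hd
  refine ⟨h, (hℳ.hdepth_le hmax).antisymm ?_, ⟨hmax _ hlower, hupper h hh, hP h hh⟩, ?_⟩
  · exact hℳ.le_hdepth hφ ((hupper h hh).trans hcard) (hdec h (hupper h hh) (hP h hh))
  · rintro d ⟨-, hd, hPd⟩
    exact hmax d (decomposable_le_nonnegSeries _ (hdec d hd hPd))

end Depth

section BlockIdeals

variable (K : Type u) [Field K] {r : ℕ} (n : Fin r → ℕ)

theorem exists_hdepth_idealGrading_eq_isGreatest (hn : ∀ i, 1 ≤ n i) :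
    ∃ h : ℕ, hdepth (Σ i : Fin r, Fin (n i)) (idealGrading (blockIdeal K n)) = h ∧
      IsGreatest {d : ℕ | ∑ i, (n i + 1) / 2 ≤ d ∧ d ≤ (∑ i, n i + r) / 2 ∧
        ∀ k : ℕ, r ≤ k → k ≤ d → 0 ≤ idealSum n d k} h := by
  have hcard : Fintype.card (Σ i : Fin r, Fin (n i)) = ∑ i, n i := by simp
  have hr : r ≤ ∑ i, n i := by
    simpa using Finset.sum_le_sum fun i (_ : i ∈ Finset.univ) => hn i
  have hle : (∑ i, n i + r) / 2 ≤ ∑ i, n i := by omega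
  refine (hasHilbertSeries_idealGrading_blockIdeal n).exists_hdepth_eq_isGreatest
    (hcard ▸ hle) (negPow_mul_idealSeries_nonneg n) (fun d => le_of_idealSeries_nonneg n hn)
    (fun d hd k _ _ => coeff_negPow_mul_idealSeries n d k ▸ hd k) fun d hd h => ?_
  rw [hcard]
  refine negPow_mul_idealSeries_mem_decomposable n (hd.trans hle) fun k hk => ?_
  rcases lt_or_ge k r with hkr | hkr
  · exact (idealSum_eq_zero n hkr).ge
  · exact h k hkr hk

theorem exists_hdepth_quotientGrading_eq_isGreatest [NeZero r] (hn : ∀ i, 1 ≤ n i) :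
    ∃ h : ℕ, hdepth (Σ i : Fin r, Fin (n i)) (quotientGrading (blockIdeal K n)) = h ∧
      IsGreatest {d : ℕ |
        ∑ i, (n i + 1) / 2 - Finset.univ.inf' Finset.univ_nonempty (fun i => (n i + 1) / 2) ≤ d ∧
        d ≤ ∑ i, n i - Finset.univ.inf' Finset.univ_nonempty n ∧
        ∀ k : ℕ, r ≤ k → k ≤ d → 0 ≤ quotientSum n d k} h := by
  have hcard : Fintype.card (Σ i : Fin r, Fin (n i)) = ∑ i, n i := by simp
  obtain ⟨j, -, hj⟩ := Finset.exists_mem_eq_inf' Finset.univ_nonempty fun i => (n i + 1) / 2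
  rw [hj]
  refine (hasHilbertSeries_quotientGrading_blockIdeal n).exists_hdepth_eq_isGreatest
    (hcard ▸ Nat.sub_le _ _) (negPow_mul_quotientSeries_nonneg n j (hn j))
    (fun d => le_of_quotientSeries_nonneg n fun i => Finset.inf'_le n (Finset.mem_univ i))
    (fun d hd k _ _ => coeff_negPow_mul_quotientSeries n d k ▸ hd k) fun d hd h => ?_
  rw [hcard]
  have hdN : d ≤ ∑ i, n i := hd.trans (Nat.sub_le _ _)
  refine negPow_mul_quotientSeries_mem_decomposable n hdN fun k hk => ?_
  rcases lt_or_ge k r with hkr | hkr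
  · exact quotientSum_nonneg_of_lt n hdN hkr
  · exact h k hkr hk

end BlockIdeals

lemma natCeil_natCast_div_two (n : ℕ) : ⌈(n : ℚ) / 2⌉₊ = (n + 1) / 2 := by
  refine eq_of_forall_ge_iff fun m => ?_
  rw [Nat.ceil_le, div_le_iff₀ two_pos, ← Nat.cast_ofNat, ← Nat.cast_mul, Nat.cast_le]
  omega

end HilbertDepth

theorem proposition3p8 {K : Type u} [Field K] {r : ℕ} [NeZero r] (n : Fin r → ℕ)
    (hn : ∀ i, 1 ≤ n i) :
    (∃ h : ℕ,
      HilbertDepth.hdepth (Σ i : Fin r, Fin (n i))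
        (HilbertDepth.idealGrading (HilbertDepth.blockIdeal K n)) = (h : ℕ∞) ∧
      IsGreatest {d : ℕ |
        ∑ i, ⌈(n i : ℚ) / 2⌉₊ ≤ d ∧ d ≤ ⌊((∑ i, (n i : ℚ)) + r) / 2⌋₊ ∧
        ∀ k : ℕ, r ≤ k → k ≤ d → 0 ≤ HilbertDepth.idealSum n d k} h) ∧
    (∃ h : ℕ,
      HilbertDepth.hdepth (Σ i : Fin r, Fin (n i))
        (HilbertDepth.quotientGrading (HilbertDepth.blockIdeal K n)) = (h : ℕ∞) ∧
      IsGreatest {d : ℕ |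
        (∑ i, ⌈(n i : ℚ) / 2⌉₊) - Finset.univ.inf' Finset.univ_nonempty (fun i => ⌈(n i : ℚ) / 2⌉₊)
          ≤ d ∧
        d ≤ (∑ i, n i) - Finset.univ.inf' Finset.univ_nonempty n ∧
        ∀ k : ℕ, r ≤ k → k ≤ d → 0 ≤ HilbertDepth.quotientSum n d k} h) := by
  have hfloor : ⌊((∑ i, (n i : ℚ)) + r) / 2⌋₊ = (∑ i, n i + r) / 2 := by
    exact_mod_cast Nat.floor_div_eq_div (K := ℚ) (∑ i, n i + r) 2
  simp only [HilbertDepth.natCeil_natCast_div_two, hfloor]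
  exact ⟨HilbertDepth.exists_hdepth_idealGrading_eq_isGreatest K n hn,
    HilbertDepth.exists_hdepth_quotientGrading_eq_isGreatest K n hn⟩
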